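/- Let $(\Omega,\mathcal P)$ be a probability space and $0<A<B<1$. Let $(a_n,b_n)_{n\ge1}$ be i.i.d. random pairs with $A\le\min(a_n,b_n)$ and $a_n+b_n\le B$. Let $(p_n)_{n\ge1}$ be i.i.d. random variables in $[0,1]$, independent of $(a_n,b_n)_{n\ge 1}$, with $\mathbb E(p_1^{-t})<\infty$ and $\mathbb E((1-p_1)^{-t})<\infty$ for some $t>0$ (where $0^{-t}=\infty$). For each $\omega$, start from the interval $[0,1]$ of level $0$; an interval $I$ of level $n-1$ has two children of level $n$: the subinterval of length $a_n|I|$ sharing its left endpoint and the subinterval of length $b_n|I|$ sharing its right endpoint. Let $\mu_\omega$ be the Borel probability measure with $\mu_\omega([0,1])=1$ that gives the left and right child of each interval $I$ of level $n-1$ the masses $p_n\,\mu_\omega(I)$ and $(1-p_n)\,\mu_\omega(I)$, respectively. For $\theta\ge0$ put $(Y,Z)=(\log p_1,\log a_1)$ if $p_1\le \frac{a_1^\theta}{a_1^\theta+b_1^\theta}$ and $(Y,Z)=(\log(1-p_1),\log b_1)$ otherwise, and put $(Y',Z')=(\log p_1,\log a_1)$ if $p_1> \frac{a_1^\theta}{a_1^\theta+b_1^\theta}$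 and $(Y',Z')=(\log(1-p_1),\log b_1)$ otherwise. Set $G(\theta)=\mathbb E(Y)/\mathbb E(Z)$ and $G'(\theta)=\mathbb E(Y')/\mathbb E(Z')$. A dimension function is a map $\Phi:(0,1)\to[0,\infty)$ such that $t^{1+\Phi(t)}$ decreases to $0$ as $t$ decreases to $0$. It is large if $\Phi(t)=H(t)\,\frac{\log|\log t|}{|\log t|}$ for all $t$ near $0$, where $H(t)\to\infty$ as $t\to0$. For a finite Borel measure $\mu$ on $\mathbb R$, $\overline{\dim}_\Phi\mu$ is the infimum of all $d\in\mathbb R$ for which there are $C_1,C_2>0$ such that $$\frac{\mu(B(x,R))}{\mu(B(x,r))}\le C_2\Big(\frac Rr\Big)^d\quad\text{for all } x\in\operatorname{supp}\mu \text{ and all } 0<r<R^{1+\Phi(R)},\ 0<R<1,\ R\le C_1,$$ and $\underline{\dim}_\Phi\mu$ is the supremum of all $d$ for which this holds with $\ge$ in place of $\le$. The upper and lower local dimensions $\overline{\dim}_{\mathrm{loc}}\mu(x)$, $\underline{\dim}_{\mathrm{loc}}\mu(x)$ at $x\in\operatorname{supp}\mu$ are the $\limsup$ and $\liminf$ of $\frac{\log\mu(B(x,r))}{\log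 r}$ as $r\to0^+$. Here $B(x,r)$ is the open ball. **Proposition.** (i) Let $\theta\ge0$ satisfy $G(\theta)=\theta$ and $G(\psi)<\psi$ for all $\psi>\theta$. Then for almost every $\omega$, $$\sup_{x\in\operatorname{supp}\mu_\omega}\overline{\dim}_{\mathrm{loc}}\mu_\omega(x)=\theta=\overline{\dim}_\Phi\mu_\omega\quad\text{for every large dimension function }\Phi.$$ (ii) Let $\theta'\ge0$ satisfy $G'(\theta')=\theta'$ and $G'(\psi)>\psi$ for all $0\le\psi<\theta'$. Then for almost every $\omega$, $$\inf_{x\in\operatorname{supp}\mu_\omega}\underline{\dim}_{\mathrm{loc}}\mu_\omega(x)=\theta'=\underline{\dim}_\Phi\mu_\omega\quad\text{for every large dimension function }\Phi.$$ -/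

import Mathlib

open MeasureTheory ProbabilityTheory Filter Set
open scoped Topology ENNReal

noncomputable section

/-! ### Assouad-like dimensions and local dimensions of measures on the line -/

/-- A dimension function is a map `Φ : (0,1) → [0,∞)` such that `t ^ (1 + Φ t)` decreases to `0`
as `t` decreases to `0`. Only the values of `Φ` on `(0,1)` matter. -/
structure IsDimensionFunction (Φ : ℝ → ℝ) : Prop where
  nonneg : ∀ t ∈ Ioo (0 : ℝ) 1, 0 ≤ Φ t
  monotoneOn : MonotoneOn (fun t : ℝ => t ^ (1 + Φ t)) (Ioo 0 1)
  tendsto_zero : Tendsto (fun t : ℝ => t ^ (1 + Φ t)) (𝓝[>] 0) (𝓝 0)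

/-- A dimension function `Φ` is large if `Φ t = H t * log |log t| / |log t|` near `0`,
where `H t → ∞` as `t → 0`. -/
def IsLargeDimensionFunction (Φ : ℝ → ℝ) : Prop :=
  IsDimensionFunction Φ ∧ ∃ H : ℝ → ℝ, Tendsto H (𝓝[>] 0) atTop ∧
    ∀ᶠ t in 𝓝[>] (0 : ℝ), Φ t = H t * (Real.log |Real.log t| / |Real.log t|)

/-- The upper `Φ`-dimension of a measure, as an extended real number. -/
def upperPhiDim (Φ : ℝ → ℝ) (μ : Measure ℝ) : EReal :=
  sInf ((fun d : ℝ => (d : EReal)) '' {d : ℝ | ∃ C₁ > 0, ∃ C₂ > 0,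
    ∀ R r : ℝ, 0 < R → R < 1 → R ≤ C₁ → 0 < r → r < R ^ (1 + Φ R) → ∀ x ∈ μ.support,
      μ.real (Metric.ball x R) / μ.real (Metric.ball x r) ≤ C₂ * (R / r) ^ d})

/-- The lower `Φ`-dimension of a measure, as an extended real number. -/
def lowerPhiDim (Φ : ℝ → ℝ) (μ : Measure ℝ) : EReal :=
  sSup ((fun d : ℝ => (d : EReal)) '' {d : ℝ | ∃ C₁ > 0, ∃ C₂ > 0,
    ∀ R r : ℝ, 0 < R → R < 1 → R ≤ C₁ → 0 < r → r < R ^ (1 + Φ R) → ∀ x ∈ μ.support,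
      C₂ * (R / r) ^ d ≤ μ.real (Metric.ball x R) / μ.real (Metric.ball x r)})

/-- The upper local dimension of `μ` at a point `x` of its support. -/
def upperLocalDim (μ : Measure ℝ) (x : ℝ) : EReal :=
  limsup (fun r : ℝ => ((Real.log (μ.real (Metric.ball x r)) / Real.log r : ℝ) : EReal)) (𝓝[>] 0)

/-- The lower local dimension of `μ` at a point `x` of its support. -/
def lowerLocalDim (μ : Measure ℝ) (x : ℝ) : EReal :=
  liminf (fun r : ℝ => ((Real.log (μ.real (Metric.ball x r)) / Real.log r : ℝ) : EReal)) (𝓝[>] 0)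

/-! ### Moran intervals and Moran measures

The sequences are indexed from `0`: the step from level `n` to level `n + 1` uses
`a n`, `b n`, `p n`. A word is read off a sequence `v : ℕ → Bool`, where `false` stands for the
left child and `true` for the right child. -/

/-- The length of the Moran interval of level `n` along `v`. -/
def moranLength (a b : ℕ → ℝ) (v : ℕ → Bool) : ℕ → ℝ
  | 0 => 1
  | n + 1 => (if v n then b n else a n) * moranLength a b v n

/-- The left endpoint of the Moran interval of level `n` along `v`: the left child shares the left
endpoint of its parent, the right child shares the right endpoint of its parent. -/
def moranLeft (a b : ℕ → ℝ) (v : ℕ → Bool) : ℕ → ℝ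
  | 0 => 0
  | n + 1 => moranLeft a b v n + if v n then (1 - b n) * moranLength a b v n else 0

/-- The Moran interval of level `n` along `v`; it depends only on `v 0, …, v (n - 1)`. -/
def moranInterval (a b : ℕ → ℝ) (v : ℕ → Bool) (n : ℕ) : Set ℝ :=
  Icc (moranLeft a b v n) (moranLeft a b v n + moranLength a b v n)

/-- The point of the Moran set lying in all the Moran intervals along `v`. -/
def moranPoint (a b : ℕ → ℝ) (v : ℕ → Bool) : ℝ := ⨆ n, moranLeft a b v n

/-- The Moran measure: the law of the point `moranPoint a b v` when the digits `v n` are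
independent, the left child being chosen at step `n` with probability `p n` and the right child
with probability `1 - p n`. -/
def moranMeasure (a b : ℕ → ℝ) (p : ℕ → unitInterval) : Measure ℝ :=
  (Measure.infinitePi fun n => bernoulliMeasure false true (p n)).map (moranPoint a b)

section MoranFacts

variable {a b : ℕ → ℝ}

theorem moranLength_pos (ha : ∀ n, 0 < a n) (hb : ∀ n, 0 < b n) (v : ℕ → Bool) (n : ℕ) :
    0 < moranLength a b v n := by
  induction n with
  | zero => simp [moranLength]
  | succ n ih =>
    rw [moranLength]
    split_ifs
    · exact mul_pos (hb n) ih
    · exact mul_pos (ha n) ih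

theorem moranInterval_succ_subset (ha : ∀ n, 0 < a n) (hb : ∀ n, 0 < b n)
    (hab : ∀ n, a n + b n < 1) (v : ℕ → Bool) (n : ℕ) :
    moranInterval a b v (n + 1) ⊆ moranInterval a b v n := by
  have hl := moranLength_pos ha hb v n
  have h1 := ha n
  have h2 := hb n
  have h3 := hab n
  refine Icc_subset_Icc ?_ ?_ <;> simp only [moranLeft, moranLength] <;> split_ifs <;> nlinarith

theorem moranPoint_mem (ha : ∀ n, 0 < a n) (hb : ∀ n, 0 < b n)
    (hab : ∀ n, a n + b n < 1) (v : ℕ → Bool) (n : ℕ) :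
    moranPoint a b v ∈ moranInterval a b v n := by
  have h := antitone_nat_of_succ_le (f := moranInterval a b v)
    (fun n => moranInterval_succ_subset ha hb hab v n)
  have := ciSup_mem_iInter_Icc_of_antitone_Icc (f := moranLeft a b v)
    (g := fun n => moranLeft a b v n + moranLength a b v n) h
    (fun n => by linarith [moranLength_pos ha hb v n])
  exact mem_iInter.1 this n

theorem moranLeft_length_congr {v w : ℕ → Bool} {n : ℕ} (h : ∀ i < n, v i = w i) :
    moranLeft a b v n = moranLeft a b w n ∧ moranLength a b v n = moranLength a b w n := by
  induction n with
  | zero => simp [moranLeft, moranLength]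
  | succ n ih =>
    obtain ⟨h1, h2⟩ := ih fun i hi => h i (by omega)
    simp only [moranLeft, moranLength, h1, h2, h n (by omega), and_self]

theorem eq_of_mem_moranInterval (ha : ∀ n, 0 < a n) (hb : ∀ n, 0 < b n)
    (hab : ∀ n, a n + b n < 1) {v w : ℕ → Bool} {y : ℝ} {n : ℕ}
    (hv : y ∈ moranInterval a b v n) (hw : y ∈ moranInterval a b w n) :
    ∀ i < n, v i = w i := by
  induction n with
  | zero => intro i hi; omega
  | succ n ih =>
    have h := ih (moranInterval_succ_subset ha hb hab v n hv)
      (moranInterval_succ_subset ha hb hab w n hw)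
    intro i hi
    rcases Nat.lt_succ_iff_lt_or_eq.1 hi with hi | rfl
    · exact h i hi
    obtain ⟨h1, h2⟩ := moranLeft_length_congr (a := a) (b := b) h
    have hl := moranLength_pos ha hb w i
    have h3 := hab i
    simp only [moranInterval, moranLeft, moranLength, mem_Icc, h1, h2] at hv hw
    cases hvi : v i <;> cases hwi : w i <;> simp only [hvi, hwi] at hv hw ⊢ <;>
      simp at hv hw <;> nlinarith

theorem measurable_moranPoint (a b : ℕ → ℝ) : Measurable (moranPoint a b) := by
  have hlen : ∀ n, Measurable fun v => moranLength a b v n := by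
    intro n
    induction n with
    | zero => simp only [moranLength]; fun_prop
    | succ n ih =>
      simp only [moranLength]
      exact (Measurable.ite (measurableSet_eq_fun (measurable_pi_apply n) measurable_const)
        measurable_const measurable_const).mul ih
  have hleft : ∀ n, Measurable fun v => moranLeft a b v n := by
    intro n
    induction n with
    | zero => simp only [moranLeft]; fun_prop
    | succ n ih =>
      simp only [moranLeft]
      exact ih.add (Measurable.ite (measurableSet_eq_fun (measurable_pi_apply n) measurable_const)
        ((hlen n).const_mul _) measurable_const)
  exact Measurable.iSup hleft

/-- The rule that determines the Moran measure: the mass of a Moran interval is the product of the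
weights of its ancestors; in particular `[0,1]` has mass `1`, and the left and the right child of a
Moran interval of level `n` receive the fractions `p n` and `1 - p n` of its mass. -/
theorem moranMeasure_moranInterval (ha : ∀ n, 0 < a n) (hb : ∀ n, 0 < b n)
    (hab : ∀ n, a n + b n < 1) (p : ℕ → unitInterval) (v : ℕ → Bool) (n : ℕ) :
    moranMeasure a b p (moranInterval a b v n) =
      ∏ i ∈ Finset.range n, ENNReal.ofReal (if v i then 1 - (p i : ℝ) else p i) := by
  have hpre : moranPoint a b ⁻¹' moranInterval a b v n =
      (Finset.range n : Set ℕ).pi fun i => {v i} := by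
    ext w
    simp only [mem_preimage, Set.mem_pi, Finset.coe_range, mem_Iio, mem_singleton_iff]
    constructor
    · exact fun h => eq_of_mem_moranInterval ha hb hab (moranPoint_mem ha hb hab w n) h
    · intro h
      obtain ⟨h1, h2⟩ := moranLeft_length_congr (a := a) (b := b) h
      have := moranPoint_mem ha hb hab w n
      rwa [moranInterval, h1, h2] at this
  have hmeas : MeasurableSet (moranInterval a b v n) := measurableSet_Icc
  rw [moranMeasure, Measure.map_apply (measurable_moranPoint a b) hmeas, hpre,
    Measure.infinitePi_pi _ (fun i _ => measurableSet_singleton _)]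
  refine Finset.prod_congr rfl fun i _ => ?_
  rw [bernoulliMeasure_def]
  have h0 : unitInterval.toNNReal (p i) = (p i : ℝ).toNNReal :=
    NNReal.eq (Real.coe_toNNReal _ (p i).2.1).symm
  have h1 : unitInterval.toNNReal (unitInterval.symm (p i)) = (1 - (p i : ℝ)).toNNReal :=
    NNReal.eq (Real.coe_toNNReal _ (unitInterval.symm (p i)).2.1).symm
  cases v i <;> simp [ENNReal.ofReal, h0, h1]

end MoranFacts

/-! ### The random model -/

/-- The standing assumptions on the random data: the pairs `(a n, b n)` are i.i.d. with
`A ≤ min (a n) (b n)` and `a n + b n ≤ B`, where `0 < A < B < 1`; the weights `p n ∈ [0,1]` are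
i.i.d. and independent of the pairs; and `𝔼 (p n)⁻ᵗ < ∞`, `𝔼 (1 - p n)⁻ᵗ < ∞` for some `t > 0`
(expectations in `[0,∞]`, with `0⁻ᵗ = ∞`). -/
structure IsRandomMoranModel {Ω : Type*} [MeasurableSpace Ω] (P : Measure Ω) (A B : ℝ)
    (a b : ℕ → Ω → ℝ) (p : ℕ → Ω → unitInterval) : Prop where
  A_pos : 0 < A
  A_lt_B : A < B
  B_lt_one : B < 1
  A_le_min : ∀ n ω, A ≤ min (a n ω) (b n ω)
  add_le_B : ∀ n ω, a n ω + b n ω ≤ B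
  measurable_a : ∀ n, Measurable (a n)
  measurable_b : ∀ n, Measurable (b n)
  measurable_p : ∀ n, Measurable (p n)
  iIndepFun_ab : iIndepFun (fun n ω => (a n ω, b n ω)) P
  identDistrib_ab : ∀ n, IdentDistrib (fun ω => (a n ω, b n ω)) (fun ω => (a 0 ω, b 0 ω)) P P
  iIndepFun_p : iIndepFun p P
  identDistrib_p : ∀ n, IdentDistrib (p n) (p 0) P P
  indepFun_ab_p : IndepFun (fun ω n => (a n ω, b n ω)) (fun ω n => p n ω) P
  moment_p : ∃ t : ℝ, 0 < t ∧
    ∫⁻ ω, ENNReal.ofReal (p 0 ω : ℝ) ^ (-t) ∂P < ∞ ∧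
    ∫⁻ ω, ENNReal.ofReal (1 - (p 0 ω : ℝ)) ^ (-t) ∂P < ∞

/-- `G θ = 𝔼 Y / 𝔼 Z`, where `Y = log p`, `Z = log a` if `p ≤ a ^ θ / (a ^ θ + b ^ θ)`, and
`Y = log (1 - p)`, `Z = log b` otherwise, for a random triple `(a, b, p)`. -/
def moranG {Ω : Type*} [MeasurableSpace Ω] (P : Measure Ω) (a b : Ω → ℝ) (p : Ω → unitInterval)
    (θ : ℝ) : ℝ :=
  (∫ ω, (if (p ω : ℝ) ≤ a ω ^ θ / (a ω ^ θ + b ω ^ θ)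
      then Real.log (p ω) else Real.log (1 - (p ω : ℝ))) ∂P) /
    ∫ ω, (if (p ω : ℝ) ≤ a ω ^ θ / (a ω ^ θ + b ω ^ θ)
      then Real.log (a ω) else Real.log (b ω)) ∂P

/-- `G' θ = 𝔼 Y' / 𝔼 Z'`, defined like `G` with the relation between `p` and
`a ^ θ / (a ^ θ + b ^ θ)` interchanged: `Y' = log p`, `Z' = log a` if
`p > a ^ θ / (a ^ θ + b ^ θ)`, and `Y' = log (1 - p)`, `Z' = log b` otherwise. -/
def moranG' {Ω : Type*} [MeasurableSpace Ω] (P : Measure Ω) (a b : Ω → ℝ) (p : Ω → unitInterval)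
    (θ : ℝ) : ℝ :=
  (∫ ω, (if a ω ^ θ / (a ω ^ θ + b ω ^ θ) < (p ω : ℝ)
      then Real.log (p ω) else Real.log (1 - (p ω : ℝ))) ∂P) /
    ∫ ω, (if a ω ^ θ / (a ω ^ θ + b ω ^ θ) < (p ω : ℝ)
      then Real.log (a ω) else Real.log (b ω)) ∂P

/-- The random Moran measure `μ_ω`. -/
def randomMoranMeasure {Ω : Type*} (a b : ℕ → Ω → ℝ) (p : ℕ → Ω → unitInterval) (ω : Ω) :
    Measure ℝ :=
  moranMeasure (fun n => a n ω) (fun n => b n ω) (fun n => p n ω)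

end

/-! ### Independence of sequences of pairs -/

/-! Since a_n + b_n ≤ B < 1, the two children of an interval I are separated by a gap of at least (1
- B)|I|, so a ball centred in the support can be traded for a Moran interval of comparable length
(`exists_interval_of_ball_le`, `exists_interval_le_ball`). Lengths and masses of Moran intervals are
products along a path, so every dimension estimate becomes an estimate of sums of d log(length
ratio) - log(mass ratio). For part (i), the larger of the two values of this summand at level n is a
random variable X_n(d) (`extremalStep` with σ = 1). The X_n(d) are i.i.d., they dominate the
summands of all paths simultaneously, and one path attains them all. The threshold in the definition
of G selects the maximizing child, so X(θ) = θZ - Y and G(θ) = θ says that X(θ) has mean zero. Upper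
bound: raising d above θ makes the mean of X(d) negative. The moment condition on p gives
exponential moments, and Chernoff with Borel-Cantelli (`ae_sum_Ico_nonpos`) makes all sums over
windows [N, N + k) nonpositive once N is large and k ≥ K log(N + 1). A large Φ forces exactly such
windows: N is of order |log R|, while k is at least of order H(R) log|log R| (`exists_levels`).
Hence the upper Φ-dimension is at most d. Lower bound: at d = θ the strong law makes the sums along
the maximizing path o(n), so its limit point has upper local dimension at least θ. Fixing R and
letting r → 0 shows that upper local dimensions never exceed the upper Φ-dimension, which closes the
circle. Part (ii) is the same argument with minima in place of maxima; the sign σ = -1 turns one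
case into the other. -/

/-- Measurable rectangles form a generating π-system. On rectangles, independence of the two whole
sequences splits off the Y-part, and independence within each sequence then factors the rest. -/
theorem iIndepFun_prodMk {Ω α β : Type*} [MeasurableSpace Ω] {P : Measure Ω}
    [MeasurableSpace α] [MeasurableSpace β]
    {X : ℕ → Ω → α} {Y : ℕ → Ω → β} (hX : ∀ n, Measurable (X n)) (hY : ∀ n, Measurable (Y n))
    (hiX : iIndepFun X P) (hiY : iIndepFun Y P)
    (hXY : IndepFun (fun ω n => X n ω) (fun ω n => Y n ω) P) :
    iIndepFun (fun n ω => (X n ω, Y n ω)) P := by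
  have hpi : IsPiSystem (image2 (· ×ˢ ·) {s : Set α | MeasurableSet s}
      {t : Set β | MeasurableSet t}) := isPiSystem_prod
  refine iIndepSets.iIndep (fun n => ((hX n).prodMk (hY n)).comap_le)
    (fun n => {S | ∃ s ∈ image2 (· ×ˢ ·) {s : Set α | MeasurableSet s}
      {t : Set β | MeasurableSet t}, (fun ω => (X n ω, Y n ω)) ⁻¹' s = S})
    (fun n => hpi.comap _) (fun n => ?_) ?_
  · rw [← generateFrom_prod (α := α) (β := β), MeasurableSpace.comap_generateFrom]
    rfl
  rw [iIndepSets_iff]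
  intro s f hf
  have hex : ∀ i : ℕ, ∃ A : Set α, ∃ B : Set β, MeasurableSet A ∧ MeasurableSet B ∧
      (i ∈ s → f i = X i ⁻¹' A ∩ Y i ⁻¹' B) := by
    intro i
    by_cases hi : i ∈ s
    · obtain ⟨_, ⟨A, hA, B, hB, rfl⟩, h⟩ := hf i hi
      exact ⟨A, B, hA, hB, fun _ => h.symm⟩
    · exact ⟨∅, ∅, MeasurableSet.empty, MeasurableSet.empty, fun h => absurd h hi⟩
  choose A B hA hB hAB using hex
  have key : ∀ u : Finset ℕ, P ((⋂ i ∈ u, X i ⁻¹' A i) ∩ ⋂ i ∈ u, Y i ⁻¹' B i) =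
      (∏ i ∈ u, P (X i ⁻¹' A i)) * ∏ i ∈ u, P (Y i ⁻¹' B i) := by
    intro u
    have h1 := hXY.measure_inter_preimage_eq_mul ((u : Set ℕ).pi A) ((u : Set ℕ).pi B)
      (MeasurableSet.pi u.countable_toSet fun i _ => hA i)
      (MeasurableSet.pi u.countable_toSet fun i _ => hB i)
    rw [← hiX.measure_inter_preimage_eq_mul u (sets := A) fun i _ => hA i,
      ← hiY.measure_inter_preimage_eq_mul u (sets := B) fun i _ => hB i]
    convert h1 using 3 <;> (ext ω; simp [Set.mem_pi])
  -- The one-element case of `key` recombines the two products into a product over pairs.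
  have hone : ∀ i, P (X i ⁻¹' A i ∩ Y i ⁻¹' B i) = P (X i ⁻¹' A i) * P (Y i ⁻¹' B i) := fun i => by
    simpa using key {i}
  rw [Finset.prod_congr rfl fun i hi => by rw [hAB i hi, hone i], Finset.prod_mul_distrib, ← key s]
  congr 1
  ext ω
  simp only [mem_iInter, mem_inter_iff]
  constructor
  · intro h
    exact ⟨fun i hi => (hAB i hi ▸ h i hi : ω ∈ X i ⁻¹' A i ∩ Y i ⁻¹' B i).1,
      fun i hi => (hAB i hi ▸ h i hi : ω ∈ X i ⁻¹' A i ∩ Y i ⁻¹' B i).2⟩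
  · intro h i hi
    rw [hAB i hi]
    exact ⟨h.1 i hi, h.2 i hi⟩

/-! ### Partial sums of i.i.d. sequences of negative mean -/

section IID

variable {Ω : Type*} [MeasurableSpace Ω] {P : Measure Ω} [IsProbabilityMeasure P]

/-- The moment generating function equals 1 at 0 and has the negative mean as its derivative there,
so it drops below 1 immediately to the right. -/
theorem exists_mgf_lt_one {X : Ω → ℝ} (hX : 0 ∈ interior (integrableExpSet X P))
    (hneg : ∫ ω, X ω ∂P < 0) :
    ∃ s : ℝ, 0 < s ∧ Integrable (fun ω => Real.exp (s * X ω)) P ∧ mgf X P s < 1 := by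
  have hd : HasDerivAt (mgf X P) (∫ ω, X ω ∂P) 0 := by
    simpa using hasDerivAt_mgf hX
  have h1 : ∀ᶠ s in 𝓝[>] (0 : ℝ), slope (mgf X P) 0 s < 0 :=
    ((hasDerivAt_iff_tendsto_slope.1 hd).mono_left
      (nhdsWithin_mono _ fun s hs => (ne_of_gt hs))).eventually (gt_mem_nhds hneg)
  have h2 : ∀ᶠ s in 𝓝[>] (0 : ℝ), s ∈ integrableExpSet X P :=
    nhdsWithin_le_nhds (mem_interior_iff_mem_nhds.1 hX)
  obtain ⟨s, h1, h2, hs⟩ := (h1.and (h2.and self_mem_nhdsWithin)).exists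
  have hs : 0 < s := hs
  refine ⟨s, hs, h2, ?_⟩
  rw [slope_def_field, div_neg_iff] at h1
  rcases h1 with h1 | h1
  · linarith [h1.2]
  · simpa using h1.1

/-- Chernoff bound at level 0. It depends on the length k of the window but not on its position N.
-/
theorem measure_sum_pos_le {X : ℕ → Ω → ℝ} (hm : ∀ n, Measurable (X n)) (hind : iIndepFun X P)
    (hid : ∀ n, IdentDistrib (X n) (X 0) P P) {s : ℝ} (hs : 0 < s)
    (hint : Integrable (fun ω => Real.exp (s * X 0 ω)) P) (N k : ℕ) :
    P {ω | 0 < ∑ i ∈ Finset.Ico N (N + k), X i ω} ≤ ENNReal.ofReal (mgf (X 0) P s ^ k) := by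
  have hint' : ∀ i, Integrable (fun ω => Real.exp (s * X i ω)) P := fun i =>
    ((hid i).comp (u := fun x => Real.exp (s * x)) (by fun_prop)).integrable_iff.2 hint
  have hsum : Integrable (fun ω => Real.exp (s * (∑ i ∈ Finset.Ico N (N + k), X i) ω)) P :=
    hind.integrable_exp_mul_sum hm fun i _ => hint' i
  have h1 := measure_ge_le_exp_mul_mgf (μ := P) 0 hs.le hsum
  rw [hind.mgf_sum hm, Finset.prod_congr rfl fun i _ => congrFun (mgf_congr_identDistrib (hid i)) s,
    Finset.prod_const, Nat.card_Ico, mul_zero, Real.exp_zero, one_mul, Nat.add_sub_cancel_left]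
    at h1
  rw [← ofReal_measureReal]
  refine ENNReal.ofReal_le_ofReal (le_trans (measureReal_mono fun ω h => ?_) h1)
  simpa using le_of_lt h

/-- Almost surely, the sums of `k` consecutive terms from index `N` on are nonpositive as soon as
`N` is large and `k` exceeds a large multiple of `log (N + 1)`. -/
theorem ae_sum_Ico_nonpos {X : ℕ → Ω → ℝ} (hm : ∀ n, Measurable (X n)) (hind : iIndepFun X P)
    (hid : ∀ n, IdentDistrib (X n) (X 0) P P) (hX : 0 ∈ interior (integrableExpSet (X 0) P))
    (hneg : ∫ ω, X 0 ω ∂P < 0) :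
    ∀ᵐ ω ∂P, ∃ (K : ℝ) (n₀ : ℕ), ∀ N k : ℕ, n₀ ≤ N → K * Real.log (N + 1) ≤ k →
      ∑ i ∈ Finset.Ico N (N + k), X i ω ≤ 0 := by
  obtain ⟨s, hs, hint, hlt⟩ := exists_mgf_lt_one hX hneg
  set ρ := mgf (X 0) P s with hρ
  have hρ0 : 0 < ρ := mgf_pos hint
  set τ := Real.sqrt ρ with hτ
  have hτ0 : 0 < τ := Real.sqrt_pos.2 hρ0
  have hτ1 : τ < 1 := by rw [hτ, Real.sqrt_lt' one_pos]; simpa using hlt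
  have hττ : τ * τ = ρ := Real.mul_self_sqrt hρ0.le
  have hlog : Real.log τ < 0 := Real.log_neg hτ0 hτ1
  -- The Chernoff bound ρ^k is split as τ^k · τ^k. With this K, the condition k ≥ K log(N + 1) makes
  -- one factor at most (N + 1)⁻², summable in N; the other factor is summable in k.
  set K := 2 / (-Real.log τ) with hK
  let E : ℕ × ℕ → Set Ω := fun q =>
    {ω | K * Real.log (q.1 + 1) ≤ q.2 ∧ 0 < ∑ i ∈ Finset.Ico q.1 (q.1 + q.2), X i ω}
  have hE : ∀ q, P (E q) ≤ ENNReal.ofReal ((1 / ((q.1 : ℝ) + 1) ^ 2) * τ ^ q.2) := by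
    intro q
    by_cases hq : K * Real.log (q.1 + 1) ≤ q.2
    · refine (measure_mono fun ω h => h.2).trans
        ((measure_sum_pos_le hm hind hid hs hint q.1 q.2).trans (ENNReal.ofReal_le_ofReal ?_))
      rw [← hρ, ← hττ, mul_pow]
      refine mul_le_mul_of_nonneg_right ?_ (pow_nonneg hτ0.le _)
      have hpos : (0 : ℝ) < (q.1 : ℝ) + 1 := by positivity
      rw [← Real.log_le_log_iff (pow_pos hτ0 _) (by positivity), one_div, Real.log_inv,
        Real.log_pow, Real.log_pow]
      rw [hK, div_mul_eq_mul_div, div_le_iff₀ (by linarith)] at hq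
      push_cast
      linarith
    · have : E q = ∅ := by ext ω; simp only [E, mem_ofPred_eq, hq, false_and, mem_empty_iff_false]
      simp [this]
  have hsum : Summable fun q : ℕ × ℕ => (1 / ((q.1 : ℝ) + 1) ^ 2) * τ ^ q.2 := by
    refine Summable.mul_of_nonneg (f := fun n : ℕ => 1 / ((n : ℝ) + 1) ^ 2) ?_
      (summable_geometric_of_lt_one hτ0.le hτ1) (fun n => by positivity) (fun n => by positivity)
    have := (summable_nat_add_iff 1).2 (Real.summable_one_div_nat_pow.2 (one_lt_two))
    simpa using this
  have hfin : ∑' q, P (E q) ≠ ∞ := by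
    refine ne_top_of_le_ne_top ?_ (ENNReal.tsum_le_tsum hE)
    rw [← ENNReal.ofReal_tsum_of_nonneg (fun q => by positivity) hsum]
    exact ENNReal.ofReal_ne_top
  filter_upwards [ae_finite_setOfPred_mem hfin] with ω hω
  -- By Borel-Cantelli only finitely many pairs (N, k) are exceptional, so a lower bound on N alone
  -- avoids them all.
  obtain ⟨M, hM⟩ := (hω.image Prod.fst).bddAbove
  refine ⟨K, M + 1, fun N k hN hk => ?_⟩
  by_contra! hcon
  have : N ≤ M := hM ⟨(N, k), ⟨hk, hcon⟩, rfl⟩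
  omega

end IID

noncomputable section

/-! ### Geometry of Moran measures -/

/-- The ratio of the lengths of the Moran intervals of levels `n + 1` and `n` along `v`. -/
def moranRatio (a b : ℕ → ℝ) (v : ℕ → Bool) (n : ℕ) : ℝ := if v n then b n else a n

/-- The ratio of the masses of the Moran intervals of levels `n + 1` and `n` along `v`. -/
def moranWeight (p : ℕ → unitInterval) (v : ℕ → Bool) (n : ℕ) : ℝ := if v n then 1 - p n else p n

theorem moranLength_succ (a b : ℕ → ℝ) (v : ℕ → Bool) (n : ℕ) :
    moranLength a b v (n + 1) = moranRatio a b v n * moranLength a b v n := rfl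

/-- The deterministic standing assumptions on the data of a Moran measure. -/
structure MoranBounds (A B : ℝ) (a b : ℕ → ℝ) (p : ℕ → unitInterval) : Prop where
  A_pos : 0 < A
  B_lt_one : B < 1
  A_le_a : ∀ n, A ≤ a n
  A_le_b : ∀ n, A ≤ b n
  add_le : ∀ n, a n + b n ≤ B
  p_pos : ∀ n, 0 < (p n : ℝ)
  p_lt_one : ∀ n, (p n : ℝ) < 1

instance isProbabilityMeasure_moranMeasure (a b : ℕ → ℝ) (p : ℕ → unitInterval) :
    IsProbabilityMeasure (moranMeasure a b p) :=
  Measure.isProbabilityMeasure_map (measurable_moranPoint a b).aemeasurable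

namespace MoranBounds

variable {A B : ℝ} {a b : ℕ → ℝ} {p : ℕ → unitInterval}

section Elementary

variable (h : MoranBounds A B a b p)
include h

theorem a_pos (n : ℕ) : 0 < a n := h.A_pos.trans_le (h.A_le_a n)

theorem b_pos (n : ℕ) : 0 < b n := h.A_pos.trans_le (h.A_le_b n)

theorem add_lt (n : ℕ) : a n + b n < 1 := (h.add_le n).trans_lt h.B_lt_one

theorem A_lt_one : A < 1 := by
  linarith [h.A_le_a 0, h.A_le_b 0, h.add_le 0, h.B_lt_one, h.A_pos]

theorem ratio_mem (v : ℕ → Bool) (n : ℕ) : moranRatio a b v n ∈ Icc A (1 - A) := by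
  have := h.A_le_a n
  have := h.A_le_b n
  have := h.add_lt n
  unfold moranRatio
  split_ifs <;> constructor <;> linarith

theorem ratio_pos (v : ℕ → Bool) (n : ℕ) : 0 < moranRatio a b v n :=
  h.A_pos.trans_le (h.ratio_mem v n).1

theorem weight_pos (v : ℕ → Bool) (n : ℕ) : 0 < moranWeight p v n := by
  have := h.p_pos n
  have := h.p_lt_one n
  unfold moranWeight
  split_ifs <;> linarith

theorem length_pos (v : ℕ → Bool) (n : ℕ) : 0 < moranLength a b v n :=
  moranLength_pos h.a_pos h.b_pos v n

theorem log_length (v : ℕ → Bool) (n : ℕ) :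
    Real.log (moranLength a b v n) = ∑ i ∈ Finset.range n, Real.log (moranRatio a b v i) := by
  induction n with
  | zero => simp [moranLength]
  | succ n ih =>
    rw [moranLength_succ, Real.log_mul (h.ratio_pos v n).ne' (h.length_pos v n).ne', ih,
      Finset.sum_range_succ, add_comm]

theorem length_antitone (v : ℕ → Bool) : Antitone (moranLength a b v) :=
  antitone_nat_of_succ_le fun n => by
    rw [moranLength_succ]
    have := h.A_pos
    exact mul_le_of_le_one_left (h.length_pos v n).le (by linarith [(h.ratio_mem v n).2])

theorem length_le_pow (v : ℕ → Bool) (n : ℕ) : moranLength a b v n ≤ (1 - A) ^ n := by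
  induction n with
  | zero => simp [moranLength]
  | succ n ih =>
    rw [moranLength_succ, pow_succ']
    exact mul_le_mul (h.ratio_mem v n).2 ih (h.length_pos v n).le (by linarith [h.A_lt_one])

theorem exists_length_lt (v : ℕ → Bool) {ε : ℝ} (hε : 0 < ε) : ∃ n, moranLength a b v n < ε := by
  obtain ⟨n, hn⟩ := exists_pow_lt_of_lt_one hε (show 1 - A < 1 by linarith [h.A_pos])
  exact ⟨n, (h.length_le_pow v n).trans_lt hn⟩

theorem measureReal_interval (v : ℕ → Bool) (n : ℕ) :
    (moranMeasure a b p).real (moranInterval a b v n) =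
      ∏ i ∈ Finset.range n, moranWeight p v i := by
  rw [measureReal_def, moranMeasure_moranInterval h.a_pos h.b_pos h.add_lt, ENNReal.toReal_prod]
  exact Finset.prod_congr rfl fun i _ => ENNReal.toReal_ofReal (h.weight_pos v i).le

theorem measureReal_interval_pos (v : ℕ → Bool) (n : ℕ) :
    0 < (moranMeasure a b p).real (moranInterval a b v n) := by
  rw [h.measureReal_interval]
  exact Finset.prod_pos fun i _ => h.weight_pos v i

theorem log_measureReal_interval (v : ℕ → Bool) (n : ℕ) :
    Real.log ((moranMeasure a b p).real (moranInterval a b v n)) =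
      ∑ i ∈ Finset.range n, Real.log (moranWeight p v i) := by
  rw [h.measureReal_interval, Real.log_prod fun i _ => (h.weight_pos v i).ne']

theorem point_mem (v : ℕ → Bool) (n : ℕ) : moranPoint a b v ∈ moranInterval a b v n :=
  moranPoint_mem h.a_pos h.b_pos h.add_lt v n

theorem dist_point_le {v w : ℕ → Bool} {n : ℕ} (hvw : ∀ i < n, v i = w i) :
    dist (moranPoint a b w) (moranPoint a b v) ≤ moranLength a b v n := by
  obtain ⟨h1, h2⟩ := moranLeft_length_congr (a := a) (b := b) hvw
  have hv := h.point_mem v n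
  have hw := h.point_mem w n
  rw [moranInterval, ← h1, ← h2] at hw
  rw [moranInterval] at hv
  rw [Real.dist_eq, abs_le]
  constructor <;> linarith [hv.1, hv.2, hw.1, hw.2]

/-- The paths part at level n into different children of one interval, and the gap between these has
relative size 1 - a n - b n ≥ 1 - B. -/
theorem le_dist_point {v w : ℕ → Bool} {n : ℕ} (hvw : ∀ i < n, v i = w i) (hn : v n ≠ w n) :
    (1 - B) * moranLength a b v n ≤ dist (moranPoint a b w) (moranPoint a b v) := by
  obtain ⟨h1, h2⟩ := moranLeft_length_congr (a := a) (b := b) hvw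
  have hv := h.point_mem v (n + 1)
  have hw := h.point_mem w (n + 1)
  have hl := h.length_pos v n
  have hB := mul_le_mul_of_nonneg_right (h.add_le n) hl.le
  simp only [moranInterval, moranLeft, moranLength, mem_Icc, ← h1, ← h2] at hv hw
  rw [Real.dist_eq]
  cases hvn : v n <;> cases hwn : w n <;> simp only [hvn, hwn, ne_eq, not_true_eq_false] at hv hw hn
  · simp only [Bool.false_eq_true, if_true, if_false] at hv hw
    exact le_trans (by nlinarith) (le_abs_self _)
  · simp only [Bool.false_eq_true, if_true, if_false] at hv hw
    exact le_trans (by nlinarith) (neg_le_abs _)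

theorem continuous_point : Continuous (moranPoint a b) := by
  refine continuous_iff_continuousAt.2 fun v => Metric.tendsto_nhds.2 fun ε hε => ?_
  obtain ⟨n, hn⟩ := h.exists_length_lt v hε
  have : ∀ᶠ w in 𝓝 v, ∀ i ∈ Finset.range n, v i = w i :=
    (Finset.eventually_all _).2 fun i _ =>
      ((continuous_apply i).tendsto v).eventually
        (show ∀ᶠ y in 𝓝 (v i), v i = y by simp [nhds_discrete])
  filter_upwards [this] with w hw
  exact (h.dist_point_le fun i hi => hw i (Finset.mem_range.2 hi)).trans_lt hn

theorem measureReal_ball_le {v : ℕ → Bool} {n : ℕ} {r : ℝ}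
    (hr : r ≤ (1 - B) * moranLength a b v n) :
    (moranMeasure a b p).real (Metric.ball (moranPoint a b v) r) ≤
      (moranMeasure a b p).real (moranInterval a b v n) := by
  have hm := measurable_moranPoint a b
  rw [moranMeasure, moranInterval, map_measureReal_apply hm measurableSet_ball,
    map_measureReal_apply hm measurableSet_Icc]
  refine measureReal_mono fun w hw => ?_
  rw [mem_preimage, Metric.mem_ball] at hw
  have hvw : ∀ i < n, v i = w i := by
    -- At the first disagreement, before level n, the gap is at least (1 - B) times a length no
    -- smaller than that of level n, hence at least r.
    by_contra! hcon
    obtain ⟨hk1, hk2⟩ := Nat.find_spec hcon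
    have := h.le_dist_point (v := v) (w := w) (n := Nat.find hcon) (fun i hi => by
      by_contra hne
      exact Nat.find_min hcon hi ⟨hi.trans hk1, hne⟩) hk2
    have hl := mul_le_mul_of_nonneg_left (h.length_antitone v hk1.le)
      (show 0 ≤ 1 - B by linarith [h.B_lt_one])
    linarith
  obtain ⟨h1, h2⟩ := moranLeft_length_congr (a := a) (b := b) hvw
  have hw := h.point_mem w n
  rwa [moranInterval, ← h1, ← h2] at hw

theorem le_measureReal_ball {v : ℕ → Bool} {n : ℕ} {r : ℝ} (hr : moranLength a b v n < r) :
    (moranMeasure a b p).real (moranInterval a b v n) ≤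
      (moranMeasure a b p).real (Metric.ball (moranPoint a b v) r) := by
  refine measureReal_mono fun y hy => ?_
  have hv := h.point_mem v n
  rw [Metric.mem_ball, Real.dist_eq, abs_lt]
  constructor <;> linarith [hv.1, hv.2, hy.1, hy.2]

theorem measureReal_ball_pos (v : ℕ → Bool) {r : ℝ} (hr : 0 < r) :
    0 < (moranMeasure a b p).real (Metric.ball (moranPoint a b v) r) := by
  obtain ⟨n, hn⟩ := h.exists_length_lt v hr
  exact (h.measureReal_interval_pos v n).trans_le (h.le_measureReal_ball hn)

/-- The range is the continuous image of a compact space, hence closed, and has full measure.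
Conversely every ball about a point of it contains a Moran interval, whose mass is positive because
no weight vanishes. -/
theorem support_eq_range : (moranMeasure a b p).support = range (moranPoint a b) := by
  apply Subset.antisymm
  · refine Measure.support_subset_of_isClosed (isCompact_range h.continuous_point).isClosed ?_
    rw [mem_ae_iff, moranMeasure, Measure.map_apply (measurable_moranPoint a b)
      (isCompact_range h.continuous_point).isClosed.measurableSet.compl]
    convert measure_empty (μ := Measure.infinitePi fun n => bernoulliMeasure false true (p n))
    ext v
    simp
  · rintro _ ⟨v, rfl⟩
    rw [Measure.mem_support_iff_forall]
    intro U hU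
    obtain ⟨r, hr, hrU⟩ := Metric.mem_nhds_iff.1 hU
    exact (ENNReal.toReal_pos_iff.1 (h.measureReal_ball_pos v hr)).1.trans_le (measure_mono hrU)

/-- A ball centred in the support has at most the mass of a Moran interval of comparable length. -/
theorem exists_interval_of_ball_le (v : ℕ → Bool) {r : ℝ} (hr : 0 < r) (hrB : r ≤ 1 - B) :
    ∃ n, |Real.log (moranLength a b v n) - Real.log r| ≤ -Real.log (A * (1 - B)) ∧
      (moranMeasure a b p).real (Metric.ball (moranPoint a b v) r) ≤
        (moranMeasure a b p).real (moranInterval a b v n) := by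
  have hB : 0 < 1 - B := by linarith [h.B_lt_one]
  -- The level used is the predecessor of the first one with (1 - B)|I| < r. It is the last level
  -- whose gaps still exceed the radius, and the next ratio is at least A, so its length is at most
  -- r / (A(1 - B)).
  have hex : ∃ n, moranLength a b v n < r / (1 - B) := h.exists_length_lt v (div_pos hr hB)
  have h0 : Nat.find hex ≠ 0 := by
    intro h0
    have := Nat.find_spec hex
    rw [h0, moranLength, one_lt_div hB] at this
    linarith
  obtain ⟨n, hn⟩ := Nat.exists_eq_succ_of_ne_zero h0
  have h1 := Nat.find_spec hex
  have h2 := Nat.find_min hex (m := n) (by omega)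
  rw [hn, Nat.succ_eq_add_one, moranLength_succ, lt_div_iff₀ hB] at h1
  rw [not_lt, div_le_iff₀ hB] at h2
  have hl := h.length_pos v n
  have hA := h.A_pos
  have h3 := mul_le_mul_of_nonneg_right (h.ratio_mem v n).1 hl.le
  refine ⟨n, ?_, h.measureReal_ball_le (by linarith)⟩
  have e1 := Real.log_le_log hr h2
  have e2 := Real.log_le_log (by positivity)
    (show (A * (1 - B)) * moranLength a b v n ≤ r by nlinarith)
  rw [Real.log_mul hl.ne' hB.ne'] at e1
  rw [Real.log_mul (by positivity) hl.ne'] at e2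
  rw [Real.log_mul hA.ne' hB.ne'] at e2 ⊢
  have e3 := Real.log_neg hA h.A_lt_one
  have e4 : Real.log (1 - B) < 0 := Real.log_neg hB (by linarith [h.a_pos 0, h.b_pos 0, h.add_le 0])
  rw [abs_le]
  constructor <;> linarith

/-- A ball centred in the support has at least the mass of a Moran interval of comparable
length. -/
theorem exists_interval_le_ball (v : ℕ → Bool) {r : ℝ} (hr : 0 < r) (hrB : r ≤ 1 - B) :
    ∃ n, |Real.log (moranLength a b v n) - Real.log r| ≤ -Real.log (A * (1 - B)) ∧
      (moranMeasure a b p).real (moranInterval a b v n) ≤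
        (moranMeasure a b p).real (Metric.ball (moranPoint a b v) r) := by
  have hB : 0 < 1 - B := by linarith [h.B_lt_one]
  have hB0 : 0 < B := by linarith [h.a_pos 0, h.b_pos 0, h.add_le 0]
  -- The first level of length below r is used; its parent has length at least r, so its own length
  -- is at least A r.
  have hex : ∃ n, moranLength a b v n < r := h.exists_length_lt v hr
  have h0 : Nat.find hex ≠ 0 := by
    intro h0
    have := Nat.find_spec hex
    rw [h0, moranLength] at this
    linarith
  obtain ⟨n, hn⟩ := Nat.exists_eq_succ_of_ne_zero h0
  have h1 := Nat.find_spec hex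
  have h2 := Nat.find_min hex (m := n) (by omega)
  rw [hn, Nat.succ_eq_add_one] at h1
  rw [not_lt] at h2
  have hA := h.A_pos
  refine ⟨n + 1, ?_, h.le_measureReal_ball h1⟩
  have h3 : A * r ≤ moranLength a b v (n + 1) :=
    mul_le_mul (h.ratio_mem v n).1 h2 hr.le (h.ratio_pos v n).le
  have e1 := Real.log_le_log (h.length_pos v (n + 1)) h1.le
  have e2 := Real.log_le_log (by positivity) h3
  rw [Real.log_mul hA.ne' hr.ne'] at e2
  rw [Real.log_mul hA.ne' hB.ne']
  have e3 := Real.log_neg hA h.A_lt_one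
  have e4 : Real.log (1 - B) < 0 := Real.log_neg hB (by linarith)
  rw [abs_le]
  constructor <;> linarith

end Elementary

end MoranBounds

end

noncomputable section

/-! ### Local dimensions against `Φ`-dimensions -/

/-- A concrete large dimension function is needed to bound the local dimensions, whose definition
involves no Φ. -/
theorem isLargeDimensionFunction_one : IsLargeDimensionFunction fun _ => 1 := by
  have habs : Tendsto (fun t : ℝ => |Real.log t|) (𝓝[>] 0) atTop :=
    tendsto_abs_atBot_atTop.comp Real.tendsto_log_nhdsGT_zero
  refine ⟨⟨fun _ _ => zero_le_one, ?_, ?_⟩,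
    fun t => |Real.log t| / Real.log |Real.log t|, ?_, ?_⟩
  · intro x hx y hy hxy
    exact Real.rpow_le_rpow hx.1.le hxy (by norm_num)
  · have : Tendsto (fun t : ℝ => t ^ (1 + 1 : ℝ)) (𝓝 0) (𝓝 (0 ^ (1 + 1 : ℝ))) :=
      (Real.continuousAt_rpow_const 0 (1 + 1) (Or.inr (by norm_num))).tendsto
    rw [Real.zero_rpow (by norm_num)] at this
    exact this.mono_left nhdsWithin_le_nhds
  · have h : Tendsto (fun x : ℝ => x / Real.log x) atTop atTop := by
      have h1 : Tendsto (fun x : ℝ => Real.log x / x) atTop (𝓝[>] 0) := by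
        refine tendsto_nhdsWithin_iff.2 ⟨?_, ?_⟩
        · simpa using Real.tendsto_pow_log_div_mul_add_atTop 1 0 1 one_ne_zero
        · filter_upwards [eventually_gt_atTop 1] with x hx
          exact div_pos (Real.log_pos hx) (by linarith)
      exact h1.inv_tendsto_nhdsGT_zero.congr fun x => by rw [Pi.inv_apply, inv_div]
    exact h.comp habs
  · filter_upwards [habs.eventually_gt_atTop 1] with t ht
    have := Real.log_pos ht
    field_simp

theorem IsDimensionFunction.rpow_le_self {Φ : ℝ → ℝ} (hΦ : IsDimensionFunction Φ) {R : ℝ}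
    (hR : 0 < R) (hR1 : R < 1) : R ^ (1 + Φ R) ≤ R := by
  have := Real.rpow_le_rpow_of_exponent_ge hR hR1.le
    (show 1 ≤ 1 + Φ R by linarith [hΦ.nonneg R ⟨hR, hR1⟩])
  rwa [Real.rpow_one] at this

theorem tendsto_add_div_log (c d : ℝ) :
    Tendsto (fun r : ℝ => d + c / Real.log r) (𝓝[>] 0) (𝓝 d) := by
  simpa using (tendsto_const_nhds (x := d)).add
    (Real.tendsto_log_nhdsGT_zero.const_div_atBot c)

theorem measureReal_ball_pos_of_mem_support {μ : Measure ℝ} [IsFiniteMeasure μ] {x : ℝ}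
    (hx : x ∈ μ.support) {r : ℝ} (hr : 0 < r) : 0 < μ.real (Metric.ball x r) :=
  ENNReal.toReal_pos (((Measure.mem_support_iff_forall x).1 hx _ (Metric.ball_mem_nhds x hr)).ne')
    (measure_ne_top _ _)

/-- With R fixed, every small r is admissible, so log μ(B(x, r)) ≥ d log r + c for a constant c.
Dividing by log r < 0 and letting r → 0 removes c. -/
theorem upperLocalDim_le_upperPhiDim (Φ : ℝ → ℝ) {μ : Measure ℝ} [IsFiniteMeasure μ] {x : ℝ}
    (hx : x ∈ μ.support) : upperLocalDim μ x ≤ upperPhiDim Φ μ := by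
  refine le_sInf ?_
  rintro _ ⟨d, ⟨C₁, hC₁, C₂, hC₂, h⟩, rfl⟩
  set R := min C₁ (1 / 2) with hR
  have hR0 : 0 < R := lt_min hC₁ (by norm_num)
  have hR1 : R < 1 := (min_le_right _ _).trans_lt (by norm_num)
  set c := Real.log (μ.real (Metric.ball x R)) - Real.log C₂ - d * Real.log R with hc
  have ht : Tendsto (fun r : ℝ => ((d + c / Real.log r : ℝ) : EReal)) (𝓝[>] 0) (𝓝 (d : EReal)) :=
    (continuous_coe_real_ereal.tendsto d).comp (tendsto_add_div_log c d)
  refine le_trans (limsup_le_limsup ?_) ht.limsup_eq.le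
  have h1 : ∀ᶠ r in 𝓝[>] (0 : ℝ), r < min 1 (R ^ (1 + Φ R)) :=
    nhdsWithin_le_nhds (gt_mem_nhds (lt_min one_pos (Real.rpow_pos_of_pos hR0 _)))
  filter_upwards [h1, self_mem_nhdsWithin] with r hr hr0
  have hr0 : 0 < r := hr0
  have hb := measureReal_ball_pos_of_mem_support hx hr0
  have hB := measureReal_ball_pos_of_mem_support hx hR0
  have key := Real.log_le_log (div_pos hB hb)
    (h R r hR0 hR1 (min_le_left _ _) hr0 (hr.trans_le (min_le_right _ _)) x hx)
  rw [Real.log_div hB.ne' hb.ne',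
    Real.log_mul hC₂.ne' (Real.rpow_pos_of_pos (div_pos hR0 hr0) _).ne',
    Real.log_rpow (div_pos hR0 hr0), Real.log_div hR0.ne' hr0.ne'] at key
  have hlog : Real.log r < 0 := Real.log_neg hr0 (hr.trans_le (min_le_left _ _))
  rw [EReal.coe_le_coe_iff, div_le_iff_of_neg hlog, add_mul, div_mul_cancel₀ _ hlog.ne]
  linarith

theorem lowerPhiDim_le_lowerLocalDim (Φ : ℝ → ℝ) {μ : Measure ℝ} [IsFiniteMeasure μ] {x : ℝ}
    (hx : x ∈ μ.support) : lowerPhiDim Φ μ ≤ lowerLocalDim μ x := by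
  refine sSup_le ?_
  rintro _ ⟨d, ⟨C₁, hC₁, C₂, hC₂, h⟩, rfl⟩
  set R := min C₁ (1 / 2) with hR
  have hR0 : 0 < R := lt_min hC₁ (by norm_num)
  have hR1 : R < 1 := (min_le_right _ _).trans_lt (by norm_num)
  set c := Real.log (μ.real (Metric.ball x R)) - Real.log C₂ - d * Real.log R with hc
  have ht : Tendsto (fun r : ℝ => ((d + c / Real.log r : ℝ) : EReal)) (𝓝[>] 0) (𝓝 (d : EReal)) :=
    (continuous_coe_real_ereal.tendsto d).comp (tendsto_add_div_log c d)
  refine le_trans ht.liminf_eq.ge (liminf_le_liminf ?_)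
  have h1 : ∀ᶠ r in 𝓝[>] (0 : ℝ), r < min 1 (R ^ (1 + Φ R)) :=
    nhdsWithin_le_nhds (gt_mem_nhds (lt_min one_pos (Real.rpow_pos_of_pos hR0 _)))
  filter_upwards [h1, self_mem_nhdsWithin] with r hr hr0
  have hr0 : 0 < r := hr0
  have hb := measureReal_ball_pos_of_mem_support hx hr0
  have hB := measureReal_ball_pos_of_mem_support hx hR0
  have key := Real.log_le_log
    (mul_pos hC₂ (Real.rpow_pos_of_pos (div_pos hR0 hr0) _))
    (h R r hR0 hR1 (min_le_left _ _) hr0 (hr.trans_le (min_le_right _ _)) x hx)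
  rw [Real.log_div hB.ne' hb.ne',
    Real.log_mul hC₂.ne' (Real.rpow_pos_of_pos (div_pos hR0 hr0) _).ne',
    Real.log_rpow (div_pos hR0 hr0), Real.log_div hR0.ne' hr0.ne'] at key
  have hlog : Real.log r < 0 := Real.log_neg hr0 (hr.trans_le (min_le_left _ _))
  rw [EReal.coe_le_coe_iff, le_div_iff_of_neg hlog, add_mul, div_mul_cancel₀ _ hlog.ne]
  linarith

/-! ### `Φ`-dimensions of Moran measures -/

/-- Along every path, the sums of `σ (d log |I'| / |I| - log μ(I') / μ(I))` over `k` consecutive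
levels from level `N` on are nonpositive as soon as `N` is large and `k` exceeds a large multiple of
`log (N + 1)`. -/
def EventuallyNonposSums (a b : ℕ → ℝ) (p : ℕ → unitInterval) (σ d : ℝ) : Prop :=
  ∃ (K : ℝ) (n₀ : ℕ), ∀ N k : ℕ, n₀ ≤ N → K * Real.log (N + 1) ≤ k → ∀ v : ℕ → Bool,
    ∑ i ∈ Finset.Ico N (N + k),
      σ * (d * Real.log (moranRatio a b v i) - Real.log (moranWeight p v i)) ≤ 0

namespace MoranBounds

variable {A B : ℝ} {a b : ℕ → ℝ} {p : ℕ → unitInterval}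

section

variable (h : MoranBounds A B a b p)
include h

theorem log_length_le (v : ℕ → Bool) (n : ℕ) :
    Real.log (moranLength a b v n) ≤ n * Real.log (1 - A) := by
  rw [← Real.log_pow]
  exact Real.log_le_log (h.length_pos v n) (h.length_le_pow v n)

theorem log_length_sub_le (v : ℕ → Bool) (n k : ℕ) :
    Real.log (moranLength a b v n) - Real.log (moranLength a b v (n + k)) ≤ k * -Real.log A := by
  induction k with
  | zero => simp
  | succ k ih =>
    have h1 := Real.log_le_log h.A_pos (h.ratio_mem v (n + k)).1
    rw [← add_assoc, moranLength_succ, Real.log_mul (h.ratio_pos v _).ne' (h.length_pos v _).ne']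
    push_cast
    linarith

/-- For a large dimension function `Φ`, small `R` and `r < R ^ (1 + Φ R)`, the Moran intervals of
sizes comparable to `R` and `r` have levels `N` and `N + k` with `k` a large multiple of
`log (N + 1)`. -/
theorem exists_levels {Φ : ℝ → ℝ} (hΦ : IsLargeDimensionFunction Φ) (K : ℝ) (n₀ : ℕ) {c : ℝ}
    (hc : 0 ≤ c) :
    ∃ R₀ > 0, ∀ R r : ℝ, 0 < R → R ≤ R₀ → 0 < r → r < R ^ (1 + Φ R) → ∀ (v : ℕ → Bool) (N M : ℕ),
      |Real.log (moranLength a b v N) - Real.log R| ≤ c →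
      |Real.log (moranLength a b v M) - Real.log r| ≤ c →
      n₀ ≤ N ∧ ∃ k : ℕ, M = N + k ∧ K * Real.log (N + 1) ≤ k := by
  obtain ⟨-, H, hH, hΦH⟩ := hΦ
  set α := -Real.log A with hα
  set β := -Real.log (1 - A) with hβ
  have hα0 : 0 < α := neg_pos.2 (Real.log_neg h.A_pos h.A_lt_one)
  have hβ0 : 0 < β := neg_pos.2 (Real.log_neg (by linarith [h.A_lt_one]) (by linarith [h.A_pos]))
  have hT : Tendsto (fun t : ℝ => -Real.log t) (𝓝[>] 0) atTop :=
    tendsto_neg_atBot_atTop.comp Real.tendsto_log_nhdsGT_zero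
  -- With T = -log R, the level N is at most (T + c)/β, so this yields log(N + 1) ≤ 2 log T.
  have hsq : ∀ᶠ T : ℝ in atTop, (T + c) / β + 1 ≤ T ^ 2 := by
    filter_upwards [eventually_ge_atTop (1 / β + (c / β + 1)), eventually_ge_atTop 1] with T h1 h2
    have h3 : 0 ≤ c / β + 1 := by positivity
    rw [add_div]
    have h4 : T / β = T * (1 / β) := by ring
    nlinarith
  -- In the bound on H, the term 2c absorbs the two comparability errors and 2α|K| gives k ≥ 2|K|
  -- log T. The bound c + n₀α ≤ T forces N ≥ n₀, and e ≤ T gives log T ≥ 1.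
  have hall : ∀ᶠ R in 𝓝[>] (0 : ℝ), Φ R = H R * (Real.log |Real.log R| / |Real.log R|) ∧
      2 * c + 2 * α * |K| + 1 ≤ H R ∧ (-Real.log R + c) / β + 1 ≤ (-Real.log R) ^ 2 ∧
      c + n₀ * α ≤ -Real.log R ∧ Real.exp 1 ≤ -Real.log R := by
    filter_upwards [hΦH, hH.eventually_ge_atTop (2 * c + 2 * α * |K| + 1), hT.eventually hsq,
      hT.eventually_ge_atTop (c + n₀ * α), hT.eventually_ge_atTop (Real.exp 1)]
      with R h1 h2 h3 h4 h5
    exact ⟨h1, h2, h3, h4, h5⟩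
  obtain ⟨ε, hε, hall⟩ := (nhdsGT_basis (0 : ℝ)).eventually_iff.1 hall
  refine ⟨ε / 2, half_pos hε, fun R r hR hRε hr hrR v N M hN hM => ?_⟩
  obtain ⟨h1, h2, h3, h4, h5⟩ := hall ⟨hR, by linarith⟩
  set T := -Real.log R with hTdef
  have hTpos : 0 < T := (Real.exp_pos 1).trans_le h5
  have hlogT : 1 ≤ Real.log T := (Real.le_log_iff_exp_le hTpos).2 h5
  have hlogR : Real.log R = -T := by rw [hTdef, neg_neg]
  have hlogr : Real.log r < -T - H R * Real.log T := by
    have := Real.log_lt_log hr hrR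
    rw [Real.log_rpow hR, h1, hlogR, abs_neg, abs_of_pos hTpos] at this
    have e : (1 + H R * (Real.log T / T)) * -T = -T - H R * Real.log T := by
      field_simp
      ring
    linarith
  rw [abs_le] at hN hM
  rw [hlogR] at hN
  have hN1 : -Real.log (moranLength a b v N) ≤ N * α := by
    have := h.log_length_sub_le v 0 N
    rwa [Nat.zero_add, moranLength, Real.log_one, zero_sub] at this
  have hN2 : N * β ≤ -Real.log (moranLength a b v N) := by
    have := h.log_length_le v N
    rw [hβ]
    linarith
  have hHT : 2 * c + 2 * α * |K| * Real.log T + 1 ≤ H R * Real.log T := by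
    have e1 := mul_le_mul_of_nonneg_right h2 (zero_le_one.trans hlogT)
    nlinarith
  have hdiff : 2 * α * |K| * Real.log T + 1 ≤
      Real.log (moranLength a b v N) - Real.log (moranLength a b v M) := by
    linarith [hN.1, hM.2]
  have hpos : 0 ≤ 2 * α * |K| * Real.log T := by positivity
  have hNM : N ≤ M := by
    by_contra! hcon
    have := Real.log_le_log (h.length_pos v N) (h.length_antitone v hcon.le)
    linarith
  obtain ⟨k, rfl⟩ := Nat.exists_eq_add_of_le hNM
  refine ⟨?_, k, rfl, ?_⟩
  · have : (n₀ : ℝ) * α ≤ N * α := by linarith [hN.2]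
    exact_mod_cast le_of_mul_le_mul_right this hα0
  · have hk := h.log_length_sub_le v N k
    have hlogN : Real.log (N + 1) ≤ 2 * Real.log T := by
      have e1 : (N : ℝ) ≤ (T + c) / β := by
        rw [le_div_iff₀ hβ0]
        linarith [hN.1]
      have e2 := Real.log_le_log (by positivity) (show (N : ℝ) + 1 ≤ T ^ 2 by linarith)
      rwa [Real.log_pow] at e2
    have hlogN0 : 0 ≤ Real.log ((N : ℝ) + 1) :=
      Real.log_nonneg (by linarith [N.cast_nonneg (α := ℝ)])
    have e3 : α * (|K| * (2 * Real.log T)) ≤ α * k := by linarith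
    have e4 := le_of_mul_le_mul_left e3 hα0
    calc K * Real.log (N + 1) ≤ |K| * Real.log (N + 1) :=
          mul_le_mul_of_nonneg_right (le_abs_self K) hlogN0
      _ ≤ |K| * (2 * Real.log T) := mul_le_mul_of_nonneg_left hlogN (abs_nonneg K)
      _ ≤ k := e4

/-- Log-lengths and log-masses telescope, so nonpositivity of the sum is a power law comparing mass
ratios with length ratios. -/
theorem sum_Ico_eq (σ d : ℝ) (v : ℕ → Bool) (N k : ℕ) :
    ∑ i ∈ Finset.Ico N (N + k),
      σ * (d * Real.log (moranRatio a b v i) - Real.log (moranWeight p v i)) =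
    σ * (d * (Real.log (moranLength a b v (N + k)) - Real.log (moranLength a b v N)) -
      (Real.log ((moranMeasure a b p).real (moranInterval a b v (N + k))) -
        Real.log ((moranMeasure a b p).real (moranInterval a b v N)))) := by
  rw [h.log_length, h.log_length, h.log_measureReal_interval, h.log_measureReal_interval,
    ← Finset.mul_sum, Finset.sum_sub_distrib, ← Finset.mul_sum,
    Finset.sum_Ico_eq_sub _ (Nat.le_add_right N k), Finset.sum_Ico_eq_sub _ (Nat.le_add_right N k)]

theorem comparability_nonneg : 0 ≤ -Real.log (A * (1 - B)) := by
  have hB : 0 < 1 - B := by linarith [h.B_lt_one]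
  rw [Real.log_mul h.A_pos.ne' hB.ne']
  have e3 := Real.log_neg h.A_pos h.A_lt_one
  have e4 : Real.log (1 - B) < 0 := Real.log_neg hB (by linarith [h.a_pos 0, h.b_pos 0, h.add_le 0])
  linarith

theorem upperPhiDim_le {Φ : ℝ → ℝ} (hΦ : IsLargeDimensionFunction Φ) {d : ℝ}
    (hd : EventuallyNonposSums a b p 1 d) : upperPhiDim Φ (moranMeasure a b p) ≤ d := by
  obtain ⟨K, n₀, hd⟩ := hd
  set c := -Real.log (A * (1 - B)) with hc
  obtain ⟨R₀, hR₀, hlev⟩ := h.exists_levels hΦ K n₀ h.comparability_nonneg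
  have hB : 0 < 1 - B := by linarith [h.B_lt_one]
  -- The factor exp(2c|d|) pays for replacing log R and log r by log-lengths, each off by at most c.
  refine sInf_le
    ⟨d, ⟨min R₀ (1 - B), lt_min hR₀ hB, Real.exp (2 * c * |d|), Real.exp_pos _, ?_⟩, rfl⟩
  intro R r hR hR1 hRC hr hrR x hx
  rw [h.support_eq_range] at hx
  obtain ⟨v, rfl⟩ := hx
  have hRB := hRC.trans (min_le_right _ _)
  have hrR' := hrR.le.trans (hΦ.1.rpow_le_self hR hR1)
  -- An upper bound for the quotient needs an interval heavier than the large ball and one lighter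
  -- than the small ball; the lower dimension needs the opposite choices.
  obtain ⟨N, hN, hN'⟩ := h.exists_interval_of_ball_le v hR hRB
  obtain ⟨M, hM, hM'⟩ := h.exists_interval_le_ball v hr (hrR'.trans hRB)
  obtain ⟨hn₀, k, rfl, hk⟩ := hlev R r hR (hRC.trans (min_le_left _ _)) hr hrR v N M hN hM
  have key := hd N k hn₀ hk v
  rw [h.sum_Ico_eq, one_mul] at key
  have hb := h.measureReal_ball_pos v hr
  have hB := h.measureReal_ball_pos v hR
  have e1 := Real.log_le_log hB hN'
  have e2 := Real.log_le_log (h.measureReal_interval_pos v _) hM'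
  rw [← Real.log_le_log_iff (div_pos hB hb)
    (mul_pos (Real.exp_pos _) (Real.rpow_pos_of_pos (div_pos hR hr) _)),
    Real.log_div hB.ne' hb.ne',
    Real.log_mul (Real.exp_pos _).ne' (Real.rpow_pos_of_pos (div_pos hR hr) _).ne',
    Real.log_rpow (div_pos hR hr), Real.log_div hR.ne' hr.ne', Real.log_exp]
  set X := (Real.log (moranLength a b v (N + k)) - Real.log r) -
    (Real.log (moranLength a b v N) - Real.log R) with hX
  have hX1 : |X| ≤ 2 * c := (abs_sub _ _).trans (by linarith)
  have hX2 : -(d * X) ≤ 2 * c * |d| := by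
    refine (neg_le_abs _).trans ?_
    rw [abs_mul, mul_comm]
    exact mul_le_mul_of_nonneg_right hX1 (abs_nonneg d)
  have hX3 : d * X = d * (Real.log (moranLength a b v (N + k)) - Real.log (moranLength a b v N)) +
    d * (Real.log R - Real.log r) := by rw [hX]; ring
  linarith

theorem le_lowerPhiDim {Φ : ℝ → ℝ} (hΦ : IsLargeDimensionFunction Φ) {d : ℝ}
    (hd : EventuallyNonposSums a b p (-1) d) : d ≤ lowerPhiDim Φ (moranMeasure a b p) := by
  obtain ⟨K, n₀, hd⟩ := hd
  set c := -Real.log (A * (1 - B)) with hc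
  obtain ⟨R₀, hR₀, hlev⟩ := h.exists_levels hΦ K n₀ h.comparability_nonneg
  have hB : 0 < 1 - B := by linarith [h.B_lt_one]
  refine le_sSup
    ⟨d, ⟨min R₀ (1 - B), lt_min hR₀ hB, Real.exp (-(2 * c * |d|)), Real.exp_pos _, ?_⟩, rfl⟩
  intro R r hR hR1 hRC hr hrR x hx
  rw [h.support_eq_range] at hx
  obtain ⟨v, rfl⟩ := hx
  have hRB := hRC.trans (min_le_right _ _)
  have hrR' := hrR.le.trans (hΦ.1.rpow_le_self hR hR1)
  obtain ⟨N, hN, hN'⟩ := h.exists_interval_le_ball v hR hRB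
  obtain ⟨M, hM, hM'⟩ := h.exists_interval_of_ball_le v hr (hrR'.trans hRB)
  obtain ⟨hn₀, k, rfl, hk⟩ := hlev R r hR (hRC.trans (min_le_left _ _)) hr hrR v N M hN hM
  have key := hd N k hn₀ hk v
  rw [h.sum_Ico_eq] at key
  have hb := h.measureReal_ball_pos v hr
  have hB := h.measureReal_ball_pos v hR
  have e1 := Real.log_le_log (h.measureReal_interval_pos v _) hN'
  have e2 := Real.log_le_log hb hM'
  rw [← Real.log_le_log_iff
    (mul_pos (Real.exp_pos _) (Real.rpow_pos_of_pos (div_pos hR hr) _)) (div_pos hB hb),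
    Real.log_div hB.ne' hb.ne',
    Real.log_mul (Real.exp_pos _).ne' (Real.rpow_pos_of_pos (div_pos hR hr) _).ne',
    Real.log_rpow (div_pos hR hr), Real.log_div hR.ne' hr.ne', Real.log_exp]
  set X := (Real.log (moranLength a b v (N + k)) - Real.log r) -
    (Real.log (moranLength a b v N) - Real.log R) with hX
  have hX1 : |X| ≤ 2 * c := (abs_sub _ _).trans (by linarith)
  have hX2 : d * X ≤ 2 * c * |d| := by
    refine (le_abs_self _).trans ?_
    rw [abs_mul, mul_comm]
    exact mul_le_mul_of_nonneg_right hX1 (abs_nonneg d)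
  have hX3 : d * X = d * (Real.log (moranLength a b v (N + k)) - Real.log (moranLength a b v N)) +
    d * (Real.log R - Real.log r) := by rw [hX]; ring
  linarith

/-! ### Local dimensions along a path -/

theorem tendsto_length (v : ℕ → Bool) : Tendsto (moranLength a b v) atTop (𝓝[>] 0) :=
  tendsto_nhdsWithin_iff.2 ⟨squeeze_zero (fun n => (h.length_pos v n).le) (h.length_le_pow v)
    (tendsto_pow_atTop_nhds_zero_of_lt_one (by linarith [h.A_lt_one]) (by linarith [h.A_pos])),
    Eventually.of_forall (h.length_pos v)⟩

/-- If `θ log |I| - log μ(I) = o(n)` for the Moran intervals `I` of level `n` along `v`, then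
`log μ(I) / log (κ |I|) → θ`. -/
theorem tendsto_log_div_log {v : ℕ → Bool} {θ κ : ℝ} (hκ : 0 < κ)
    (hv : Tendsto (fun n : ℕ => (∑ i ∈ Finset.range n,
      (θ * Real.log (moranRatio a b v i) - Real.log (moranWeight p v i))) / n) atTop (𝓝 0)) :
    Tendsto (fun n => Real.log ((moranMeasure a b p).real (moranInterval a b v n)) /
      Real.log (κ * moranLength a b v n)) atTop (𝓝 θ) := by
  set β := -Real.log (1 - A) with hβ
  have hβ0 : 0 < β := neg_pos.2 (Real.log_neg (by linarith [h.A_lt_one]) (by linarith [h.A_pos]))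
  have hL : Tendsto (fun n => Real.log (moranLength a b v n)) atTop atBot :=
    Real.tendsto_log_nhdsGT_zero.comp (h.tendsto_length v)
  have h1 : Tendsto (fun n => (∑ i ∈ Finset.range n,
      (θ * Real.log (moranRatio a b v i) - Real.log (moranWeight p v i))) /
        Real.log (moranLength a b v n)) atTop (𝓝 0) := by
    -- Since |log of the length| ≥ βn, an error o(n) is also negligible against the log-length.
    have hb : Tendsto (fun n : ℕ => |(∑ i ∈ Finset.range n,
      (θ * Real.log (moranRatio a b v i) - Real.log (moranWeight p v i))) / n| / β)
        atTop (𝓝 0) := by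
      simpa using hv.abs.div_const β
    refine squeeze_zero_norm' ?_ hb
    filter_upwards [eventually_gt_atTop 0] with n hn
    have hn : (0 : ℝ) < n := by exact_mod_cast hn
    have hle := h.log_length_le v n
    rw [Real.norm_eq_abs, abs_div, abs_div, div_div, Nat.abs_cast]
    refine div_le_div_of_nonneg_left (abs_nonneg _) (by positivity) ?_
    refine le_trans ?_ (neg_le_abs _)
    rw [hβ]
    linarith
  have h2 : Tendsto (fun n => Real.log ((moranMeasure a b p).real (moranInterval a b v n)) /
      Real.log (moranLength a b v n)) atTop (𝓝 θ) := by
    have := h1.const_sub θ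
    rw [sub_zero] at this
    refine this.congr' ?_
    filter_upwards [hL.eventually_lt_atBot 0] with n hn
    rw [Finset.sum_sub_distrib, ← Finset.mul_sum, ← h.log_length, ← h.log_measureReal_interval,
      sub_div, mul_div_assoc, div_self hn.ne]
    ring
  have h3 : Tendsto (fun n => Real.log κ / Real.log (moranLength a b v n) + 1) atTop (𝓝 1) := by
    simpa using (hL.const_div_atBot (Real.log κ)).add_const 1
  have h4 := h2.div h3 one_ne_zero
  rw [div_one] at h4
  refine h4.congr' ?_
  filter_upwards [hL.eventually_lt_atBot 0] with n hn
  rw [Pi.div_apply, Real.log_mul hκ.ne' (h.length_pos v n).ne', div_div, mul_add, mul_one,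
    mul_div_cancel₀ _ hn.ne]

theorem tendsto_mul_length (v : ℕ → Bool) {κ : ℝ} (hκ : 0 < κ) :
    Tendsto (fun n => κ * moranLength a b v n) atTop (𝓝[>] 0) := by
  have := tendsto_nhdsWithin_iff.1 (h.tendsto_length v)
  refine tendsto_nhdsWithin_iff.2 ⟨by simpa using this.1.const_mul κ, ?_⟩
  exact Eventually.of_forall fun n => mul_pos hκ (h.length_pos v n)

/-- At the radii (1 - B)|I_n| the ball is no heavier than I_n, and log r < 0 reverses this into a
lower bound for the quotient. A limsup along a sequence of radii bounds the full limsup from below.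
-/
theorem le_upperLocalDim {v : ℕ → Bool} {θ : ℝ}
    (hv : Tendsto (fun n : ℕ => (∑ i ∈ Finset.range n,
      (θ * Real.log (moranRatio a b v i) - Real.log (moranWeight p v i))) / n) atTop (𝓝 0)) :
    θ ≤ upperLocalDim (moranMeasure a b p) (moranPoint a b v) := by
  have hB : 0 < 1 - B := by linarith [h.B_lt_one]
  have ht := (continuous_coe_real_ereal.tendsto θ).comp (h.tendsto_log_div_log hB hv)
  have hr := h.tendsto_mul_length v hB
  rw [upperLocalDim, ← ht.limsup_eq]
  refine le_trans (limsup_le_limsup ?_) (limsup_le_limsup_of_le hr)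
  have hr1 : ∀ᶠ n in atTop, (1 - B) * moranLength a b v n < 1 :=
    (hr.mono_right nhdsWithin_le_nhds).eventually (gt_mem_nhds one_pos)
  filter_upwards [hr1] with n hn
  have hpos := mul_pos hB (h.length_pos v n)
  refine EReal.coe_le_coe_iff.2 ?_
  exact div_le_div_of_nonpos_of_le (Real.log_neg hpos hn).le
    (Real.log_le_log (h.measureReal_ball_pos v hpos) (h.measureReal_ball_le le_rfl))

theorem lowerLocalDim_le {v : ℕ → Bool} {θ : ℝ}
    (hv : Tendsto (fun n : ℕ => (∑ i ∈ Finset.range n,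
      (θ * Real.log (moranRatio a b v i) - Real.log (moranWeight p v i))) / n) atTop (𝓝 0)) :
    lowerLocalDim (moranMeasure a b p) (moranPoint a b v) ≤ θ := by
  -- The radius 2|I_n| strictly exceeds |I_n|, as needed for the open ball to contain I_n.
  have ht := (continuous_coe_real_ereal.tendsto θ).comp (h.tendsto_log_div_log two_pos hv)
  have hr := h.tendsto_mul_length v two_pos
  rw [lowerLocalDim, ← ht.liminf_eq]
  refine le_trans (liminf_le_liminf_of_le hr) ?_
  refine liminf_le_liminf (f := atTop) ?_
  have hr1 : ∀ᶠ n in atTop, 2 * moranLength a b v n < 1 :=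
    (hr.mono_right nhdsWithin_le_nhds).eventually (gt_mem_nhds one_pos)
  filter_upwards [hr1] with n hn
  have hl := h.length_pos v n
  have hpos := mul_pos two_pos hl
  refine EReal.coe_le_coe_iff.2 ?_
  exact div_le_div_of_nonpos_of_le (Real.log_neg hpos hn).le
    (Real.log_le_log (h.measureReal_interval_pos v n) (h.le_measureReal_ball (by linarith)))

end

end MoranBounds

end

noncomputable section

/-! ### The extremal steps of the random model -/

/-- For a triple `((a, b), p)`, the larger of `σ (d log a - log p)` and
`σ (d log b - log (1 - p))`. -/
def extremalStep (σ d : ℝ) (x : (ℝ × ℝ) × unitInterval) : ℝ :=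
  max (σ * (d * Real.log x.1.1 - Real.log x.2)) (σ * (d * Real.log x.1.2 - Real.log (1 - x.2)))

theorem measurable_extremalStep (σ d : ℝ) : Measurable (extremalStep σ d) := by
  unfold extremalStep
  have : Measurable fun x : (ℝ × ℝ) × unitInterval => (x.2 : ℝ) :=
    measurable_subtype_coe.comp measurable_snd
  fun_prop

/-- This makes the estimates uniform: a single i.i.d. sequence controls the uncountably many paths.
-/
theorem le_extremalStep (σ d : ℝ) (a b : ℕ → ℝ) (p : ℕ → unitInterval) (v : ℕ → Bool) (n : ℕ) :
    σ * (d * Real.log (moranRatio a b v n) - Real.log (moranWeight p v n)) ≤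
      extremalStep σ d ((a n, b n), p n) := by
  unfold moranRatio moranWeight extremalStep
  split_ifs
  · exact le_max_right _ _
  · exact le_max_left _ _

theorem exists_path_extremalStep (σ d : ℝ) (a b : ℕ → ℝ) (p : ℕ → unitInterval) :
    ∃ v : ℕ → Bool, ∀ n, extremalStep σ d ((a n, b n), p n) =
      σ * (d * Real.log (moranRatio a b v n) - Real.log (moranWeight p v n)) := by
  have : ∀ n, ∃ c : Bool, extremalStep σ d ((a n, b n), p n) =
      σ * (d * Real.log (if c then b n else a n) -
        Real.log (if c then 1 - (p n : ℝ) else p n)) := by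
    intro n
    rcases max_choice (σ * (d * Real.log (a n) - Real.log (p n)))
      (σ * (d * Real.log (b n) - Real.log (1 - (p n : ℝ)))) with h | h
    · exact ⟨false, by simpa [extremalStep] using h⟩
    · exact ⟨true, by simpa [extremalStep] using h⟩
  choose v hv using this
  exact ⟨v, hv⟩

namespace MoranBounds

variable {A B : ℝ} {a b : ℕ → ℝ} {p : ℕ → unitInterval}

theorem abs_extremalStep_le (h : MoranBounds A B a b p) {σ : ℝ} (hσ : |σ| ≤ 1) (d : ℝ) (n : ℕ) :
    |extremalStep σ d ((a n, b n), p n)| ≤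
      |d| * -Real.log A + (-Real.log (p n) + -Real.log (1 - (p n : ℝ))) := by
  have hp := Real.log_neg (h.p_pos n) (h.p_lt_one n)
  have hq : Real.log (1 - (p n : ℝ)) < 0 :=
    Real.log_neg (by linarith [h.p_lt_one n]) (by linarith [h.p_pos n])
  obtain ⟨v, hv⟩ := exists_path_extremalStep σ d a b p
  rw [hv n, abs_mul]
  refine (mul_le_of_le_one_left (abs_nonneg _) hσ).trans ((abs_sub _ _).trans ?_)
  rw [abs_mul]
  refine add_le_add (mul_le_mul_of_nonneg_left ?_ (abs_nonneg d)) ?_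
  · have h1 := Real.log_le_log h.A_pos (h.ratio_mem v n).1
    have h2 : Real.log (moranRatio a b v n) ≤ 0 :=
      Real.log_nonpos (h.ratio_pos v n).le (by linarith [(h.ratio_mem v n).2, h.A_pos])
    rw [abs_of_nonpos h2]
    linarith
  · unfold moranWeight
    split_ifs
    · rw [abs_of_neg hq]; linarith
    · rw [abs_of_neg hp]; linarith

/-- Because σ² = 1, moving d by σε changes either candidate in the maximum by ε times a log-ratio,
which is at most log(1 - A) < 0. -/
theorem extremalStep_add_le (h : MoranBounds A B a b p) {σ : ℝ} (hσ : σ * σ = 1) (d : ℝ) {ε : ℝ}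
    (hε : 0 ≤ ε) (n : ℕ) :
    extremalStep σ (d + σ * ε) ((a n, b n), p n) ≤
      extremalStep σ d ((a n, b n), p n) + ε * Real.log (1 - A) := by
  obtain ⟨v, hv⟩ := exists_path_extremalStep σ (d + σ * ε) a b p
  have h1 := le_extremalStep σ d a b p v n
  have h2 := mul_le_mul_of_nonneg_left
    (Real.log_le_log (h.ratio_pos v n) (h.ratio_mem v n).2) hε
  rw [hv n]
  have h3 : σ * ((d + σ * ε) * Real.log (moranRatio a b v n) - Real.log (moranWeight p v n)) =
      σ * (d * Real.log (moranRatio a b v n) - Real.log (moranWeight p v n)) +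
        (σ * σ) * (ε * Real.log (moranRatio a b v n)) := by ring
  rw [h3, hσ, one_mul]
  linarith

/-- The comparison of `p` with `a ^ θ / (a ^ θ + b ^ θ)` decides which child is extremal. -/
theorem le_div_iff_log (h : MoranBounds A B a b p) (θ : ℝ) (n : ℕ) :
    (p n : ℝ) ≤ a n ^ θ / (a n ^ θ + b n ^ θ) ↔
      θ * Real.log (b n) - Real.log (1 - (p n : ℝ)) ≤ θ * Real.log (a n) - Real.log (p n) := by
  have ha := Real.rpow_pos_of_pos (h.a_pos n) θ
  have hb := Real.rpow_pos_of_pos (h.b_pos n) θ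
  have hp := h.p_pos n
  have hq : 0 < 1 - (p n : ℝ) := by linarith [h.p_lt_one n]
  have h1 : (p n : ℝ) * b n ^ θ ≤ (1 - p n) * a n ^ θ ↔
      θ * Real.log (b n) - Real.log (1 - (p n : ℝ)) ≤ θ * Real.log (a n) - Real.log (p n) := by
    rw [← Real.log_le_log_iff (by positivity) (by positivity), Real.log_mul hp.ne' hb.ne',
      Real.log_mul hq.ne' ha.ne', Real.log_rpow (h.a_pos n), Real.log_rpow (h.b_pos n)]
    constructor <;> intro h <;> linarith
  rw [← h1, le_div_iff₀ (by positivity)]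
  constructor <;> intro h <;> linarith

end MoranBounds

/-! ### Moments, means and almost sure behaviour of the extremal steps. -/

theorem integrable_rpow_neg_of_lintegral_lt_top {Ω : Type*} [MeasurableSpace Ω] {P : Measure Ω}
    {q : Ω → ℝ} (hq : Measurable q) (hpos : ∀ᵐ ω ∂P, 0 < q ω) {t : ℝ}
    (hfin : ∫⁻ ω, ENNReal.ofReal (q ω) ^ (-t) ∂P < ∞) :
    Integrable (fun ω => q ω ^ (-t)) P := by
  refine ⟨(hq.pow_const _).aestronglyMeasurable, ?_⟩
  rw [hasFiniteIntegral_iff_ofReal (hpos.mono fun ω hω => (Real.rpow_pos_of_pos hω _).le)]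
  refine lt_of_le_of_lt (lintegral_mono_ae ?_) hfin
  filter_upwards [hpos] with ω hω
  rw [ENNReal.ofReal_rpow_of_pos hω]

namespace IsRandomMoranModel

variable {Ω : Type*} [MeasurableSpace Ω] {P : Measure Ω} {A B : ℝ}
  {a b : ℕ → Ω → ℝ} {p : ℕ → Ω → unitInterval}

section

variable (h : IsRandomMoranModel P A B a b p)
include h

theorem measurable_p_coe (n : ℕ) : Measurable fun ω => (p n ω : ℝ) :=
  measurable_subtype_coe.comp (h.measurable_p n)

/-- A finite negative moment excludes the values 0 and 1 of p almost surely, and equality of laws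
carries this to every level. -/
theorem ae_moranBounds :
    ∀ᵐ ω ∂P, MoranBounds A B (fun n => a n ω) (fun n => b n ω) (fun n => p n ω) := by
  obtain ⟨t, ht, h1, h2⟩ := h.moment_p
  have hm := h.measurable_p_coe 0
  have h0 : ∀ᵐ ω ∂P, 0 < (p 0 ω : ℝ) ∧ (p 0 ω : ℝ) < 1 := by
    filter_upwards [ae_lt_top (by fun_prop) h1.ne, ae_lt_top (by fun_prop) h2.ne] with ω hω1 hω2
    constructor
    · by_contra! hcon
      rw [ENNReal.ofReal_of_nonpos hcon, ENNReal.zero_rpow_of_neg (by linarith)] at hω1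
      exact lt_irrefl _ hω1
    · by_contra! hcon
      rw [ENNReal.ofReal_of_nonpos (by linarith), ENNReal.zero_rpow_of_neg (by linarith)] at hω2
      exact lt_irrefl _ hω2
  have hS : MeasurableSet {x : unitInterval | 0 < (x : ℝ) ∧ (x : ℝ) < 1} :=
    measurable_subtype_coe measurableSet_Ioo
  have hall : ∀ᵐ ω ∂P, ∀ n, 0 < (p n ω : ℝ) ∧ (p n ω : ℝ) < 1 :=
    ae_all_iff.2 fun n => (h.identDistrib_p n).symm.ae_snd hS h0
  filter_upwards [hall] with ω hω
  exact ⟨h.A_pos, h.B_lt_one, fun n => (le_min_iff.1 (h.A_le_min n ω)).1,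
    fun n => (le_min_iff.1 (h.A_le_min n ω)).2, fun n => h.add_le_B n ω, fun n => (hω n).1,
    fun n => (hω n).2⟩

theorem measurable_step (σ d : ℝ) (n : ℕ) :
    Measurable fun ω => extremalStep σ d ((a n ω, b n ω), p n ω) :=
  (measurable_extremalStep σ d).comp
    (((h.measurable_a n).prodMk (h.measurable_b n)).prodMk (h.measurable_p n))

theorem iIndepFun_step (σ d : ℝ) :
    iIndepFun (fun n ω => extremalStep σ d ((a n ω, b n ω), p n ω)) P :=
  (iIndepFun_prodMk (fun n => (h.measurable_a n).prodMk (h.measurable_b n)) h.measurable_p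
    h.iIndepFun_ab h.iIndepFun_p h.indepFun_ab_p).comp (fun _ => extremalStep σ d)
      fun _ => measurable_extremalStep σ d

theorem measurable_threshold (θ : ℝ) :
    Measurable fun ω => a 0 ω ^ θ / (a 0 ω ^ θ + b 0 ω ^ θ) :=
  ((h.measurable_a 0).pow_const θ).div
    (((h.measurable_a 0).pow_const θ).add ((h.measurable_b 0).pow_const θ))

theorem zero_mem_interior_integrableExpSet {σ : ℝ} (hσ : |σ| ≤ 1) (d : ℝ) :
    0 ∈ interior (integrableExpSet (fun ω => extremalStep σ d ((a 0 ω, b 0 ω), p 0 ω)) P) := by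
  obtain ⟨t, ht, h1, h2⟩ := h.moment_p
  have hm := h.measurable_p_coe 0
  have i1 := integrable_rpow_neg_of_lintegral_lt_top hm
    (h.ae_moranBounds.mono fun ω hω => hω.p_pos 0) h1
  have i2 := integrable_rpow_neg_of_lintegral_lt_top (hm.const_sub 1)
    (h.ae_moranBounds.mono fun ω hω => by linarith [hω.p_lt_one 0]) h2
  rw [mem_interior_iff_mem_nhds]
  refine mem_of_superset (Metric.ball_mem_nhds 0 (half_pos ht)) fun u hu => ?_
  rw [Metric.mem_ball, Real.dist_eq, sub_zero] at hu
  refine Integrable.mono' ((i1.add i2).const_mul (Real.exp (t / 2 * (|d| * -Real.log A))))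
    (Real.measurable_exp.comp ((h.measurable_step σ d 0).const_mul u)).aestronglyMeasurable ?_
  filter_upwards [h.ae_moranBounds] with ω hω
  have hp := hω.p_pos 0
  have hq : 0 < 1 - (p 0 ω : ℝ) := by linarith [hω.p_lt_one 0]
  have hbd := hω.abs_extremalStep_le hσ d 0
  -- For |u| < t/2 the exponential is bounded by a constant times xy. The halved exponent lets xy ≤
  -- x² + y² reduce this to the two separate moments of order t.
  set x := (p 0 ω : ℝ) ^ (-(t / 2)) with hx
  set y := (1 - (p 0 ω : ℝ)) ^ (-(t / 2)) with hy
  have ex : (p 0 ω : ℝ) ^ (-t) = x ^ 2 := by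
    rw [hx, ← Real.rpow_natCast, ← Real.rpow_mul hp.le]
    congr 1
    push_cast
    ring
  have ey : (1 - (p 0 ω : ℝ)) ^ (-t) = y ^ 2 := by
    rw [hy, ← Real.rpow_natCast, ← Real.rpow_mul hq.le]
    congr 1
    push_cast
    ring
  rw [Real.norm_eq_abs, Real.abs_exp, Pi.add_apply, ex, ey]
  calc Real.exp (u * extremalStep σ d ((a 0 ω, b 0 ω), p 0 ω))
      ≤ Real.exp (t / 2 * (|d| * -Real.log A) +
          (Real.log (p 0 ω) * -(t / 2) + Real.log (1 - (p 0 ω : ℝ)) * -(t / 2))) := by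
        refine Real.exp_le_exp.2 ((le_abs_self _).trans ?_)
        rw [abs_mul]
        have := mul_le_mul hu.le hbd (abs_nonneg _) (half_pos ht).le
        linarith
    _ = Real.exp (t / 2 * (|d| * -Real.log A)) * (x * y) := by
        rw [Real.exp_add, Real.exp_add, hx, hy, Real.rpow_def_of_pos hp, Real.rpow_def_of_pos hq]
    _ ≤ Real.exp (t / 2 * (|d| * -Real.log A)) * (x ^ 2 + y ^ 2) :=
        mul_le_mul_of_nonneg_left (by nlinarith [sq_nonneg (x - y), sq_nonneg (x + y)])
          (Real.exp_pos _).le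

theorem integrable_step {σ : ℝ} (hσ : |σ| ≤ 1) (d : ℝ) :
    Integrable (fun ω => extremalStep σ d ((a 0 ω, b 0 ω), p 0 ω)) P :=
  integrable_of_mem_interior_integrableExpSet (h.zero_mem_interior_integrableExpSet hσ d)

variable [IsProbabilityMeasure P]

theorem identDistrib_step (σ d : ℝ) (n : ℕ) :
    IdentDistrib (fun ω => extremalStep σ d ((a n ω, b n ω), p n ω))
      (fun ω => extremalStep σ d ((a 0 ω, b 0 ω), p 0 ω)) P P := by
  have hind : ∀ n, IndepFun (fun ω => (a n ω, b n ω)) (p n) P := fun n =>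
    h.indepFun_ab_p.comp (φ := fun x : ℕ → ℝ × ℝ => x n) (ψ := fun x : ℕ → unitInterval => x n)
      (measurable_pi_apply n) (measurable_pi_apply n)
  exact ((h.identDistrib_ab n).prodMk (h.identDistrib_p n) (hind n) (hind 0)).comp
    (measurable_extremalStep σ d)

/-- Here Y = θZ - σX with X the extremal step, and 𝔼 Z < 0 allows 𝔼 Y / 𝔼 Z = θ to be cleared to 𝔼 Y
= θ 𝔼 Z, leaving σ 𝔼 X = 0. -/
theorem integral_step_eq_zero {σ θ : ℝ} (hσ : |σ| ≤ 1) (hσ' : σ * σ = 1) {C : Ω → Prop}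
    [DecidablePred C] (hC : MeasurableSet {ω | C ω})
    (hstep : ∀ᵐ ω ∂P, extremalStep σ θ ((a 0 ω, b 0 ω), p 0 ω) =
      σ * (θ * (if C ω then Real.log (a 0 ω) else Real.log (b 0 ω)) -
        if C ω then Real.log (p 0 ω) else Real.log (1 - (p 0 ω : ℝ))))
    (hθ : (∫ ω, (if C ω then Real.log (p 0 ω) else Real.log (1 - (p 0 ω : ℝ))) ∂P) /
      (∫ ω, (if C ω then Real.log (a 0 ω) else Real.log (b 0 ω)) ∂P) = θ) :
    ∫ ω, extremalStep σ θ ((a 0 ω, b 0 ω), p 0 ω) ∂P = 0 := by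
  set Y : Ω → ℝ := fun ω => if C ω then Real.log (p 0 ω) else Real.log (1 - (p 0 ω : ℝ)) with hY
  set Z : Ω → ℝ := fun ω => if C ω then Real.log (a 0 ω) else Real.log (b 0 ω) with hZ
  have hZbd : ∀ᵐ ω ∂P, Real.log A ≤ Z ω ∧ Z ω ≤ Real.log (1 - A) := by
    filter_upwards [h.ae_moranBounds] with ω hω
    have h1 := hω.A_le_a 0
    have h2 := hω.A_le_b 0
    have h3 := hω.add_lt 0
    simp only [hZ]
    split_ifs
    · exact ⟨Real.log_le_log h.A_pos h1, Real.log_le_log (hω.a_pos 0) (by linarith)⟩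
    · exact ⟨Real.log_le_log h.A_pos h2, Real.log_le_log (hω.b_pos 0) (by linarith)⟩
  have hA1 : A < 1 := h.A_lt_B.trans h.B_lt_one
  have hlog : Real.log (1 - A) < 0 := Real.log_neg (by linarith) (by linarith [h.A_pos])
  have hZint : Integrable Z P := by
    refine Integrable.of_bound (Measurable.ite hC (h.measurable_a 0).log
      (h.measurable_b 0).log).aestronglyMeasurable (-Real.log A) (hZbd.mono fun ω hω => ?_)
    rw [Real.norm_eq_abs, abs_of_nonpos (hω.2.trans hlog.le)]
    linarith [hω.1]
  have hZneg : ∫ ω, Z ω ∂P < 0 := by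
    refine lt_of_le_of_lt (integral_mono_ae hZint (integrable_const (Real.log (1 - A)))
      (hZbd.mono fun ω hω => hω.2)) ?_
    simpa using hlog
  have hXint := h.integrable_step hσ θ
  have hYX : ∀ᵐ ω ∂P, Y ω = θ * Z ω - σ * extremalStep σ θ ((a 0 ω, b 0 ω), p 0 ω) := by
    filter_upwards [hstep] with ω hω
    rw [hω, ← mul_assoc, hσ', one_mul, sub_sub_cancel]
  rw [div_eq_iff hZneg.ne, integral_congr_ae hYX,
    integral_sub (hZint.const_mul θ) (hXint.const_mul σ), integral_const_mul, integral_const_mul]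
    at hθ
  have h1 : σ * ∫ ω, extremalStep σ θ ((a 0 ω, b 0 ω), p 0 ω) ∂P = 0 := by linarith
  exact (mul_eq_zero.1 h1).resolve_left (left_ne_zero_of_mul (hσ'.trans_ne one_ne_zero))

theorem integral_step_one_eq_zero {θ : ℝ} (hθ : moranG P (a 0) (b 0) (p 0) θ = θ) :
    ∫ ω, extremalStep 1 θ ((a 0 ω, b 0 ω), p 0 ω) ∂P = 0 := by
  refine h.integral_step_eq_zero (by norm_num) (by norm_num)
    (measurableSet_le (h.measurable_p_coe 0) (h.measurable_threshold θ)) ?_ hθ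
  filter_upwards [h.ae_moranBounds] with ω hω
  simp only [extremalStep, hω.le_div_iff_log θ 0, one_mul]
  split_ifs with hc
  · exact max_eq_left hc
  · exact max_eq_right (le_of_not_ge hc)

theorem integral_step_neg_one_eq_zero {θ : ℝ} (hθ : moranG' P (a 0) (b 0) (p 0) θ = θ) :
    ∫ ω, extremalStep (-1) θ ((a 0 ω, b 0 ω), p 0 ω) ∂P = 0 := by
  refine h.integral_step_eq_zero (by norm_num) (by norm_num)
    (measurableSet_lt (h.measurable_threshold θ) (h.measurable_p_coe 0)) ?_ hθ
  filter_upwards [h.ae_moranBounds] with ω hω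
  simp only [extremalStep, ← not_le, hω.le_div_iff_log θ 0]
  split_ifs with hc
  · exact max_eq_right (by linarith)
  · exact max_eq_left (by linarith)

theorem ae_eventuallyNonposSums {σ θ ε : ℝ} (hσ : |σ| ≤ 1) (hσ' : σ * σ = 1)
    (hzero : ∫ ω, extremalStep σ θ ((a 0 ω, b 0 ω), p 0 ω) ∂P = 0) (hε : 0 < ε) :
    ∀ᵐ ω ∂P, EventuallyNonposSums (fun n => a n ω) (fun n => b n ω) (fun n => p n ω) σ
      (θ + σ * ε) := by
  have hA1 : A < 1 := h.A_lt_B.trans h.B_lt_one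
  have hlog : Real.log (1 - A) < 0 := Real.log_neg (by linarith) (by linarith [h.A_pos])
  have hneg : ∫ ω, extremalStep σ (θ + σ * ε) ((a 0 ω, b 0 ω), p 0 ω) ∂P < 0 := by
    refine lt_of_le_of_lt (integral_mono_ae (h.integrable_step hσ _)
      ((h.integrable_step hσ θ).add (integrable_const (ε * Real.log (1 - A))))
      (h.ae_moranBounds.mono fun ω hω => hω.extremalStep_add_le hσ' θ hε.le 0)) ?_
    simp only [Pi.add_apply]
    rw [integral_add (h.integrable_step hσ θ) (integrable_const _), hzero]
    simpa using mul_neg_of_pos_of_neg hε hlog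
  filter_upwards [ae_sum_Ico_nonpos (h.measurable_step σ (θ + σ * ε))
    (h.iIndepFun_step σ (θ + σ * ε)) (h.identDistrib_step σ (θ + σ * ε))
    (h.zero_mem_interior_integrableExpSet hσ _) hneg] with ω ⟨K, n₀, hω⟩
  refine ⟨K, n₀, fun N k hN hk v => (Finset.sum_le_sum fun i _ => ?_).trans (hω N k hN hk)⟩
  exact le_extremalStep σ _ (fun n => a n ω) (fun n => b n ω) (fun n => p n ω) v i

/-- The strong law applies to the extremal steps, which have mean zero, and the path that picks the
extremal child at each level realizes them. -/
theorem ae_exists_path {σ θ : ℝ} (hσ : |σ| ≤ 1) (hσ' : σ * σ = 1)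
    (hzero : ∫ ω, extremalStep σ θ ((a 0 ω, b 0 ω), p 0 ω) ∂P = 0) :
    ∀ᵐ ω ∂P, ∃ v : ℕ → Bool, Tendsto (fun n : ℕ => (∑ i ∈ Finset.range n,
      (θ * Real.log (moranRatio (fun n => a n ω) (fun n => b n ω) v i) -
        Real.log (moranWeight (fun n => p n ω) v i))) / n) atTop (𝓝 0) := by
  have hlaw := strong_law_ae_real (fun n ω => extremalStep σ θ ((a n ω, b n ω), p n ω))
    (h.integrable_step hσ θ) (fun i j hij => (h.iIndepFun_step σ θ).indepFun hij)
    (h.identDistrib_step σ θ)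
  rw [hzero] at hlaw
  filter_upwards [hlaw] with ω hω
  obtain ⟨v, hv⟩ := exists_path_extremalStep σ θ (fun n => a n ω) (fun n => b n ω)
    (fun n => p n ω)
  refine ⟨v, ?_⟩
  have := hω.const_mul σ
  rw [mul_zero] at this
  refine this.congr fun n => ?_
  rw [Finset.sum_congr rfl fun i _ => hv i, ← Finset.mul_sum, ← mul_div_assoc, ← mul_assoc, hσ',
    one_mul]

end

end IsRandomMoranModel

/-! ### Passage from θ ± 1/(k + 1) to θ, and the proposition. -/

theorem tendsto_add_mul_one_div_succ (θ σ : ℝ) :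
    Tendsto (fun k : ℕ => ((θ + σ * (1 / ((k : ℝ) + 1)) : ℝ) : EReal)) atTop (𝓝 (θ : EReal)) := by
  refine (continuous_coe_real_ereal.tendsto θ).comp ?_
  simpa using (tendsto_one_div_add_atTop_nhds_zero_nat (𝕜 := ℝ)).const_mul σ |>.const_add θ

end

theorem mainTheorem6 {Ω : Type*} [MeasurableSpace Ω] (P : Measure Ω) [IsProbabilityMeasure P]
    (A B : ℝ) (a b : ℕ → Ω → ℝ) (p : ℕ → Ω → unitInterval)
    (hmodel : IsRandomMoranModel P A B a b p) :
    (∀ θ : ℝ, 0 ≤ θ → moranG P (a 0) (b 0) (p 0) θ = θ →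
      (∀ ψ : ℝ, θ < ψ → moranG P (a 0) (b 0) (p 0) ψ < ψ) →
      ∀ᵐ ω ∂P,
        sSup (upperLocalDim (randomMoranMeasure a b p ω) ''
          (randomMoranMeasure a b p ω).support) = (θ : EReal) ∧
        ∀ Φ : ℝ → ℝ, IsLargeDimensionFunction Φ →
          upperPhiDim Φ (randomMoranMeasure a b p ω) = (θ : EReal)) ∧
    (∀ θ' : ℝ, 0 ≤ θ' → moranG' P (a 0) (b 0) (p 0) θ' = θ' →
      (∀ ψ : ℝ, 0 ≤ ψ → ψ < θ' → ψ < moranG' P (a 0) (b 0) (p 0) ψ) →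
      ∀ᵐ ω ∂P,
        sInf (lowerLocalDim (randomMoranMeasure a b p ω) ''
          (randomMoranMeasure a b p ω).support) = (θ' : EReal) ∧
        ∀ Φ : ℝ → ℝ, IsLargeDimensionFunction Φ →
          lowerPhiDim Φ (randomMoranMeasure a b p ω) = (θ' : EReal)) := by
  constructor
  · intro θ _ hθ _
    have hzero := hmodel.integral_step_one_eq_zero hθ
    -- Countably many values of ε suffice, and these events do not involve Φ, so one null set serves
    -- all large dimension functions.
    have hsums := ae_all_iff.2 fun k : ℕ => hmodel.ae_eventuallyNonposSums (by norm_num)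
      (by norm_num) hzero (Nat.one_div_pos_of_nat (α := ℝ) (n := k))
    filter_upwards [hmodel.ae_moranBounds, hsums,
      hmodel.ae_exists_path (by norm_num) (by norm_num) hzero] with ω hω hsums ⟨v, hv⟩
    rw [randomMoranMeasure]
    set μ := moranMeasure (fun n => a n ω) (fun n => b n ω) fun n => p n ω
    have hle : ∀ Φ, IsLargeDimensionFunction Φ → upperPhiDim Φ μ ≤ θ := fun Φ hΦ =>
      ge_of_tendsto' (tendsto_add_mul_one_div_succ θ 1) fun k => hω.upperPhiDim_le hΦ (hsums k)
    have hsup : ∀ Φ, sSup (upperLocalDim μ '' μ.support) ≤ upperPhiDim Φ μ := fun Φ =>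
      sSup_le (forall_mem_image.2 fun x hx => upperLocalDim_le_upperPhiDim Φ hx)
    have hge : (θ : EReal) ≤ sSup (upperLocalDim μ '' μ.support) :=
      (hω.le_upperLocalDim hv).trans
        (le_sSup (mem_image_of_mem _ (hω.support_eq_range ▸ mem_range_self v)))
    -- The chain θ ≤ sup of local dimensions ≤ Φ-dimension ≤ θ holds for each large Φ; the constant
    -- Φ = 1 settles the middle term.
    exact ⟨le_antisymm ((hsup _).trans (hle _ isLargeDimensionFunction_one)) hge,
      fun Φ hΦ => le_antisymm (hle Φ hΦ) (hge.trans (hsup Φ))⟩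
  · intro θ _ hθ _
    have hzero := hmodel.integral_step_neg_one_eq_zero hθ
    have hsums := ae_all_iff.2 fun k : ℕ => hmodel.ae_eventuallyNonposSums (by norm_num)
      (by norm_num) hzero (Nat.one_div_pos_of_nat (α := ℝ) (n := k))
    filter_upwards [hmodel.ae_moranBounds, hsums,
      hmodel.ae_exists_path (by norm_num) (by norm_num) hzero] with ω hω hsums ⟨v, hv⟩
    rw [randomMoranMeasure]
    set μ := moranMeasure (fun n => a n ω) (fun n => b n ω) fun n => p n ω
    have hge : ∀ Φ, IsLargeDimensionFunction Φ → θ ≤ lowerPhiDim Φ μ := fun Φ hΦ =>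
      le_of_tendsto' (tendsto_add_mul_one_div_succ θ (-1)) fun k => hω.le_lowerPhiDim hΦ (hsums k)
    have hinf : ∀ Φ, lowerPhiDim Φ μ ≤ sInf (lowerLocalDim μ '' μ.support) := fun Φ =>
      le_sInf (forall_mem_image.2 fun x hx => lowerPhiDim_le_lowerLocalDim Φ hx)
    have hle : sInf (lowerLocalDim μ '' μ.support) ≤ (θ : EReal) :=
      (sInf_le (mem_image_of_mem _ (hω.support_eq_range ▸ mem_range_self v))).trans
        (hω.lowerLocalDim_le hv)
    exact ⟨le_antisymm hle ((hge _ isLargeDimensionFunction_one).trans (hinf _)),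
      fun Φ hΦ => le_antisymm ((hinf Φ).trans hle) (hge Φ hΦ)⟩
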